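/- Let $k$ be an algebraically closed field, $d\ge 1$, and let $p_2,\dots,p_d\in k^\times$ be multiplicatively independent, i.e. a free basis of the subgroup of $k^\times$ that they generate. For an automorphism $\sigma$ of a commutative $k$-algebra $T$, write $\sigma$ also for the induced automorphism of $X=\operatorname{Spec}T$; a closed subset $Z\subseteq X$ is called $\sigma$-lonely if $Z\cap\sigma^i(Z)=\emptyset$ for all integers $i\neq 0$. For $f\in T$ let $V(f)\subseteq X$ be its vanishing set. (1) (Type (A).) Suppose that $k$ has characteristic $0$. Let $T=k[x_1,x_2^{\pm1},\dots,x_d^{\pm1}]$ with the $k$-algebra automorphism $\sigma(x_1)=x_1+1$ and $\sigma(x_j)=p_jx_j$ for $2\le j\le d$, and let $f\in T$ be nonzero and not a unit. Then $V(f)$ is $\sigma$-lonely if and only if, after replacing $f$ by a unit multiple, at least one of the following holds: (i) $f\in k[x_1]$, and no two distinct roots of $f$ in $k$ differ by an integer; (ii) there is a monomial $z=x_2^{i_2}\cdots x_d^{i_d}$ with $i_2,\dots,i_d\in\mathbb Z$ such that $f=g(z)$ for some Laurent polynomial $g$ in one variable over $k$, and no two distinct roots of $g$ in $k^\times$ have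 ratio $\rho^i$ with $i\in\mathbb Z$, where $\rho=p_2^{i_2}\cdots p_d^{i_d}$ (so that $\sigma(z)=\rho z$). (2) (Type (B).) Let $k$ have arbitrary characteristic, let $T=k[x_2^{\pm1},\dots,x_d^{\pm1}]$ with the $k$-algebra automorphism $\sigma(x_j)=p_jx_j$ for $2\le j\le d$, and let $f\in T$ be nonzero and not a unit. Then $V(f)$ is $\sigma$-lonely if and only if, after replacing $f$ by a unit multiple, condition (ii) holds. -/

import Mathlib

open AlgebraicGeometry CategoryTheory Polynomial

noncomputable section

/-- A closed subset `Z` of a scheme `X` is lonely for an automorphism `σ` of `X` if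
`Z ∩ σ ^ i (Z)` is empty for every integer `i ≠ 0`. -/
def IsLonely {X : Scheme} (σ : Aut X) (Z : TopologicalSpace.Closeds X) : Prop :=
  ∀ i : ℤ, i ≠ 0 → (Z : Set X) ∩ (σ ^ i).hom '' (Z : Set X) = ∅

/-- The automorphism of `Spec T` induced by an automorphism of the `k`-algebra `T`. -/
def specAut {k T : Type*} [CommRing k] [CommRing T] [Algebra k T] (σ : T ≃ₐ[k] T) :
    Aut (Spec (CommRingCat.of T)) :=
  Scheme.Spec.mapIso σ.toRingEquiv.toCommRingCatIso.op

/-- The vanishing set `V(f)` in `Spec T`. -/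
def vanishing {T : Type*} [CommRing T] (f : T) :
    TopologicalSpace.Closeds (Spec (CommRingCat.of T)) :=
  ⟨PrimeSpectrum.zeroLocus {f}, PrimeSpectrum.isClosed_zeroLocus {f}⟩

/-- The Laurent polynomial ring over `k` in `n` variables, as the group algebra of `ℤ ^ n`. -/
abbrev LaurentRing (k : Type*) [CommRing k] (n : ℕ) := AddMonoidAlgebra k (Fin n → ℤ)

namespace LaurentRing

variable {k : Type*} [CommRing k] {n : ℕ}

/-- The Laurent monomial with exponent `a`, as a unit. -/
def monomial (a : Fin n → ℤ) : (LaurentRing k n)ˣ where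
  val := AddMonoidAlgebra.single a 1
  inv := AddMonoidAlgebra.single (-a) 1
  val_inv := by simp [AddMonoidAlgebra.single_mul_single, AddMonoidAlgebra.one_def]
  inv_val := by simp [AddMonoidAlgebra.single_mul_single, AddMonoidAlgebra.one_def]

/-- The `i`-th variable. -/
def x (i : Fin n) : LaurentRing k n := (monomial (Pi.single i 1) : (LaurentRing k n)ˣ)

/-- The value `∏ p i ^ a i` at `p` of the monomial with exponent `a`. -/
def multiplier (p : Fin n → kˣ) (a : Fin n → ℤ) : kˣ := ∏ i, p i ^ a i

/-- The algebra endomorphism multiplying the monomial with exponent `a` by `∏ p i ^ a i`. -/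
def scaleHom (p : Fin n → kˣ) : LaurentRing k n →ₐ[k] LaurentRing k n :=
  AddMonoidAlgebra.lift k _ (Fin n → ℤ)
    { toFun := fun a =>
        AddMonoidAlgebra.single a.toAdd ((multiplier p a.toAdd : kˣ) : k)
      map_one' := by simp [multiplier, AddMonoidAlgebra.one_def]
      map_mul' := fun a b => by
        simp [multiplier, AddMonoidAlgebra.single_mul_single, zpow_add,
          Finset.prod_mul_distrib] }

theorem scaleHom_single (p : Fin n → kˣ) (a : Fin n → ℤ) (c : k) :
    scaleHom p (AddMonoidAlgebra.single a c) =
      AddMonoidAlgebra.single a (c * ((multiplier p a : kˣ) : k)) := by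
  simp [scaleHom, AddMonoidAlgebra.lift_single]

theorem scaleHom_comp (p q : Fin n → kˣ) (h : ∀ i, p i * q i = 1) :
    (scaleHom p).comp (scaleHom q) = AlgHom.id k (LaurentRing k n) := by
  have h' : ∀ a, multiplier q a * multiplier p a = 1 := fun a => by
    simp only [multiplier, ← Finset.prod_mul_distrib, ← mul_zpow]
    exact Finset.prod_eq_one fun i _ => by rw [mul_comm, h i, one_zpow]
  refine AlgHom.ext fun f => ?_
  induction f using AddMonoidAlgebra.induction_linear with
  | zero => simp
  | add f g hf hg => rw [map_add, map_add, hf, hg]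
  | single a c =>
    simp only [AlgHom.comp_apply, scaleHom_single, AlgHom.id_apply]
    rw [mul_assoc, ← Units.val_mul, h' a, Units.val_one, mul_one]

/-- The automorphism `x i ↦ p i * x i` of the Laurent polynomial ring. -/
def scale (p : Fin n → kˣ) : LaurentRing k n ≃ₐ[k] LaurentRing k n :=
  AlgEquiv.ofAlgHom (scaleHom p) (scaleHom p⁻¹)
    (scaleHom_comp p p⁻¹ fun i => by simp) (scaleHom_comp p⁻¹ p fun i => by simp)

theorem scale_x (p : Fin n → kˣ) (i : Fin n) :
    scale p (x i) = ((p i : kˣ) : k) • x i := by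
  change scaleHom p (AddMonoidAlgebra.single (Pi.single i 1) 1) =
    ((p i : kˣ) : k) • AddMonoidAlgebra.single (Pi.single i 1) 1
  rw [scaleHom_single, AddMonoidAlgebra.smul_single]
  congr 1
  simp [multiplier, Pi.single_apply, Finset.prod_ite_eq', apply_ite]

theorem monomial_add (a b : Fin n → ℤ) :
    (monomial (a + b) : (LaurentRing k n)ˣ) = monomial a * monomial b :=
  Units.ext (by simp [monomial, AddMonoidAlgebra.single_mul_single])

theorem monomial_eq_prod (a : Fin n → ℤ) :
    (monomial a : (LaurentRing k n)ˣ) = ∏ i, monomial (Pi.single i 1) ^ a i := by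
  let φ : (Fin n → ℤ) →+ Additive (LaurentRing k n)ˣ :=
    AddMonoidHom.mk' (fun a => Additive.ofMul (monomial a)) monomial_add
  have h : a = ∑ i, a i • Pi.single i (1 : ℤ) := by
    ext j
    simp [Finset.sum_apply, Pi.single_apply]
  have h2 := congrArg φ h
  rw [map_sum] at h2
  simp only [map_zsmul] at h2
  exact h2

end LaurentRing

/-- The ring `k[x₁, x₂^{±1}, …, x_{n+1}^{±1}]`: polynomials in `x₁ = X` over the Laurent
polynomial ring in the other `n` variables. -/
abbrev MixedRing (k : Type*) [CommRing k] (n : ℕ) := (LaurentRing k n)[X]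

namespace MixedRing

variable {k : Type*} [CommRing k] {n : ℕ}

/-- The automorphism `X ↦ X + 1`, `x i ↦ p i * x i` of the mixed ring. -/
def translate (p : Fin n → kˣ) : MixedRing k n ≃ₐ[k] MixedRing k n :=
  (Polynomial.mapAlgEquiv (LaurentRing.scale p)).trans
    ((Polynomial.algEquivAevalXAddC (1 : LaurentRing k n)).restrictScalars k)

theorem translate_X (p : Fin n → kˣ) : translate p X = (X + 1 : MixedRing k n) := by
  simp [translate]

/-- On the Laurent subring, the automorphism of the mixed ring restricts to `scale p`. -/
theorem translate_C (p : Fin n → kˣ) (f : LaurentRing k n) :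
    translate p (C f) = C (LaurentRing.scale p f) := by
  simp [translate]

end MixedRing

/-- `f` is a polynomial over `k` in the element `x`, of which no two distinct roots differ by an
integer. -/
def AdditiveForm (k : Type*) {T : Type*} [Field k] [CommRing T] [Algebra k T] (x f : T) : Prop :=
  ∃ g : k[X], f = aeval x g ∧
    ∀ a b : k, g.IsRoot a → g.IsRoot b → a ≠ b → ∀ i : ℤ, a - b ≠ i

/-- `f` is a Laurent polynomial over `k` in the unit `z`, of which no two distinct (nonzero) roots
have as their ratio a power of `ρ`. -/
def MultiplicativeForm {k T : Type*} [Field k] [CommRing T] [Algebra k T] (z : Tˣ) (ρ : kˣ)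
    (f : T) : Prop :=
  ∃ g : LaurentPolynomial k, f = LaurentPolynomial.eval₂ (algebraMap k T) z g ∧
    ∀ a b : kˣ, LaurentPolynomial.eval₂ (RingHom.id k) a g = 0 →
      LaurentPolynomial.eval₂ (RingHom.id k) b g = 0 → a ≠ b → ∀ i : ℤ, a / b ≠ ρ ^ i

end

/-!
Write `G` for the algebraic group with coordinate ring `T` (a torus, or a line times a torus) and
`g ∈ G(k)` for the point whose translation is `σ`. The set `V(f)` is lonely if and only if no prime
ideal contains both `f` and `σ ^ i f` for some `i ≠ 0` (`isLonely_vanishing_iff`).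

Suppose that `V(f)` is lonely. The points `g ^ i` with `i ≥ 1` are Zariski dense: for the torus this
is the independence of characters (`LaurentRing.eq_zero_of_forall_evalAt_pow`), and with the line,
in characteristic `0`, the independence of the sequences `q(i) c ^ i`
(`MixedRing.eq_zero_of_forall_evalAt_pow`). None of them is a quotient of two points of `V(f)`. The
set of such quotients is constructible, so it is not dense, and it lies in a hypersurface `h = 0`;
more precisely, every translate of `f` by a point of `V(f)` divides `h`
(`exists_ne_zero_forall_translate_dvd`). As `T` is factorial, these translates fall into finitely
many classes up to units. The class of a translate determines, for the point used:
* the first coordinate, if `f` has positive degree in `X`, by comparison of the two highest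
  coefficients (`MixedRing.point_X_eq_of_associated`);
* the value of every quotient of two monomials of `f`, if `f` is a Laurent polynomial
  (`LaurentRing.point_sub_eq_of_translateBy_eq`).

So one of these functions `w` takes finitely many values on `V(f)`, and by the Nullstellensatz `f`
divides a product of elements `w - v` with `v ∈ k` (`exists_dvd_prod_sub`). The factors `X - v` are
prime, hence `f` is a unit times a polynomial in `X` in the first case. In the second case, `w` is
a power of a primitive monomial `z`; the grading of the Laurent ring by the exponent group modulo
the exponent of `z` has torsion-free degrees, hence divisors of homogeneous elements are homogeneous
and `f` is a unit times a Laurent polynomial in `z` (`LaurentRing.exists_eq_eval₂_of_dvd_prod`).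
Two roots in the same orbit would give a point in `V(f)` and one of its translates.

Conversely, a prime containing `f` and `σ ^ i f` contains `w - a` and `σ ^ i w - b` for roots `a`
and `b`, hence `a` and `b` are in the same orbit; they are distinct because `σ` has infinite order
on `w`, unless `w = 1`, which is excluded because `f` would be constant.
-/

noncomputable section

/-! ### Generic translates, points and divisors -/

open TensorProduct in
/-- Here `Δ` is thought of as the comultiplication of a commutative algebraic group `Spec T`, so
that `(x ⊗ id) ∘ Δ` and `(id ⊗ x) ∘ Δ` are both translation by the point `x`. If
the translates of `V(f)` by a Zariski dense set of points `e i` do not meet `V(f)`, then the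
quotients of two points of `V(f)` satisfy an equation `h ≠ 0`: otherwise, by Chevalley's theorem,
they would form a set containing a nonempty open one. Hence all translates of `f` by points of
`V(f)` divide `h`. -/
theorem exists_ne_zero_forall_translate_dvd {k T ι : Type*} [Field k] [CommRing T] [IsDomain T]
    [Algebra k T] [Algebra.FiniteType k T] (Δ : T →ₐ[k] T ⊗[k] T) (e : ι → T →ₐ[k] k)
    (he : ∀ h : T, (∀ i, e i h = 0) → h = 0) (f : T)
    (hf : ∀ i, ∀ P : Ideal T, P.IsPrime → f ∈ P →
      Algebra.TensorProduct.productMap ((Algebra.ofId k T).comp (e i)) (AlgHom.id k T) (Δ f) ∉ P) :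
    ∃ h : T, h ≠ 0 ∧ ∀ x : T →ₐ[k] k, x f = 0 →
      Algebra.TensorProduct.productMap (AlgHom.id k T) ((Algebra.ofId k T).comp x) (Δ f) ∣ h := by
  classical
  have hfp : Algebra.FinitePresentation k T := Algebra.FinitePresentation.of_finiteType.1 ‹_›
  let I : Ideal (T ⊗[k] T) := Ideal.span {(1 : T) ⊗ₜ f, Δ f}
  suffices hI : ∃ h : T, h ≠ 0 ∧ h ⊗ₜ (1 : T) ∈ I by
    obtain ⟨h, h0, hh⟩ := hI
    refine ⟨h, h0, fun x hx => ?_⟩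
    obtain ⟨a, b, hab⟩ := Ideal.mem_span_pair.1 hh
    have := congrArg
      (Algebra.TensorProduct.productMap (AlgHom.id k T) ((Algebra.ofId k T).comp x)) hab
    simp only [map_add, map_mul, Algebra.TensorProduct.productMap_apply_tmul, AlgHom.comp_apply,
      hx, map_zero, mul_zero, zero_add, map_one, mul_one, AlgHom.id_apply] at this
    exact ⟨_, by rw [← this, mul_comm]⟩
  by_contra! hcon
  -- `Spec (T ⊗ T ⧸ I)` consists of the pairs of a point of `V(f)` and an element moving it into
  -- `V(f)`. Projection to that element is dominant, as no nonzero `h` lies in `I`.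
  let F : T →+* (T ⊗[k] T) ⧸ I := algebraMap T _
  have hinj : Function.Injective F := by
    rw [injective_iff_map_eq_zero]
    intro h hh
    by_contra h0
    exact hcon h h0 (Ideal.Quotient.eq_zero_iff_mem.1 hh)
  have hFfp : F.FinitePresentation := by
    refine RingHom.finitePresentation_algebraMap.2 ?_
    exact Algebra.FinitePresentation.quotient
      (Submodule.fg_span (Set.toFinite _))
  obtain ⟨S, hS⟩ := PrimeSpectrum.exists_constructibleSetData_iff.2
    (PrimeSpectrum.isConstructible_range_comap hFfp)
  have hbot : (⟨⊥, Ideal.isPrime_bot⟩ : PrimeSpectrum T) ∈ S.toSet := by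
    rw [hS]
    obtain ⟨Q, hQ, hQ'⟩ := Ideal.exists_comap_eq_of_mem_minimalPrimes_of_injective hinj ⊥
      (by rw [IsDomain.minimalPrimes_eq_singleton_bot]; rfl)
    exact ⟨⟨Q, hQ⟩, PrimeSpectrum.ext hQ'⟩
  -- The piece of the image containing the generic point has no equations, so it is open.
  simp only [PrimeSpectrum.ConstructibleSetData.toSet, Set.mem_iUnion] at hbot
  obtain ⟨C, hC, hC1, hC2⟩ := hbot
  have hg : ∀ j, C.g j = 0 := fun j => by
    simpa using hC1 (Set.mem_range_self j)
  have hCf : C.f ≠ 0 := fun h => hC2 (by simp [h])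
  obtain ⟨i, hi⟩ : ∃ i, e i C.f ≠ 0 := by
    by_contra! h
    exact hCf (he _ h)
  have hmem : (⟨RingHom.ker (e i), RingHom.ker_isPrime _⟩ : PrimeSpectrum T) ∈ S.toSet := by
    simp only [PrimeSpectrum.ConstructibleSetData.toSet, Set.mem_iUnion]
    refine ⟨C, hC, ?_, ?_⟩
    · rintro _ ⟨j, rfl⟩
      simp [hg j]
    · simpa [PrimeSpectrum.mem_zeroLocus] using hi
  rw [hS] at hmem
  obtain ⟨Q, hQ⟩ := hmem
  have hQ' : ∀ t : T, F t ∈ Q.asIdeal ↔ e i t = 0 := fun t => by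
    have := congrArg PrimeSpectrum.asIdeal hQ
    rw [← RingHom.mem_ker (f := e i), ← show _ = RingHom.ker (e i) from this]
    rfl
  let π : (T ⊗[k] T) →ₐ[k] ((T ⊗[k] T) ⧸ I) ⧸ Q.asIdeal :=
    (Ideal.Quotient.mkₐ k Q.asIdeal).comp (Ideal.Quotient.mkₐ k I)
  have hπI : ∀ b ∈ I, π b = 0 := fun b hb => by
    simp [π, Ideal.Quotient.eq_zero_iff_mem.2 hb]
  -- Modulo `Q` the left tensor factor is evaluated at the point `e i`.
  have hπ : π = (π.comp Algebra.TensorProduct.includeRight).comp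
      (Algebra.TensorProduct.productMap ((Algebra.ofId k T).comp (e i)) (AlgHom.id k T)) := by
    refine Algebra.TensorProduct.ext' fun a b => ?_
    have h1 : π (a ⊗ₜ 1) = algebraMap k _ (e i a) := by
      have : F (a - algebraMap k T (e i a)) ∈ Q.asIdeal := by
        rw [hQ']
        simp
      have h2 := Ideal.Quotient.eq_zero_iff_mem.2 this
      rw [map_sub, map_sub, sub_eq_zero] at h2
      refine (show π (a ⊗ₜ 1) = _ from h2).trans ?_
      rfl
    have h2 : a ⊗ₜ[k] b = (a ⊗ₜ 1) * (1 ⊗ₜ b) := by simp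
    have h3 : π.comp Algebra.TensorProduct.includeRight (algebraMap k T (e i a)) =
      algebraMap k _ (e i a) := AlgHom.commutes _ _
    rw [h2, map_mul, h1, map_mul, AlgHom.comp_apply _ _ (a ⊗ₜ[k] (1 : T)),
      Algebra.TensorProduct.productMap_left_apply, AlgHom.comp_apply (Algebra.ofId k T),
      Algebra.ofId_apply, h3]
    simp
  let P : Ideal T := RingHom.ker (π.comp Algebra.TensorProduct.includeRight)
  refine hf i P (RingHom.ker_isPrime _) ?_ ?_
  · exact hπI _ (Ideal.subset_span (by simp))
  · have h1 := hπI (Δ f) (Ideal.subset_span (by simp))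
    rw [hπ] at h1
    exact h1

/-- The Nullstellensatz for `k`-points of `V(f)`. -/
theorem exists_dvd_pow_of_forall_point {k T : Type*} [Field k] [IsAlgClosed k] [CommRing T]
    [Algebra k T] [Algebra.FiniteType k T] (f y : T)
    (h : ∀ x : T →ₐ[k] k, x f = 0 → x y = 0) : ∃ N : ℕ, f ∣ y ^ N := by
  have : IsJacobsonRing T := isJacobsonRing_of_finiteType (A := k)
  suffices y ∈ (Ideal.span {f}).radical by
    obtain ⟨N, hN⟩ := this
    exact ⟨N, Ideal.mem_span_singleton.1 hN⟩
  rw [Ideal.radical_eq_jacobson, Ideal.jacobson, Ideal.mem_sInf]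
  rintro M ⟨hM, hMmax⟩
  let : Field (T ⧸ M) := Ideal.Quotient.field M
  have : Module.Finite k (T ⧸ M) := finite_of_finite_type_of_isJacobsonRing k (T ⧸ M)
  let E : k ≃ₐ[k] T ⧸ M := AlgEquiv.ofBijective (Algebra.ofId k (T ⧸ M))
    IsAlgClosed.algebraMap_bijective_of_isIntegral
  have hE : ∀ t : T, E.symm (Ideal.Quotient.mkₐ k M t) = 0 ↔ t ∈ M := fun t => by
    rw [map_eq_zero_iff _ E.symm.injective]
    exact Ideal.Quotient.eq_zero_iff_mem
  exact (hE y).1 (h (E.symm.toAlgHom.comp (Ideal.Quotient.mkₐ k M))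
    ((hE f).2 (hM (Ideal.mem_span_singleton_self f))))

theorem finite_associates_dvd {T : Type*} [CommRing T] [IsDomain T] [UniqueFactorizationMonoid T]
    {h : T} (h0 : h ≠ 0) : {a : Associates T | a ∣ Associates.mk h}.Finite := by
  have := UniqueFactorizationMonoid.fintypeSubtypeDvd (Associates.mk h)
    (Associates.mk_ne_zero.2 h0)
  exact Finite.of_fintype {a : Associates T // a ∣ Associates.mk h}

open TensorProduct in
/-- In a factorial `T` the element `h` of `exists_ne_zero_forall_translate_dvd` has finitely many
divisors up to units. So a function `w` whose value at `x ∈ V(f)` is determined by the associate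
class of the translate of `f` by `x` takes finitely many values on `V(f)`. -/
theorem exists_dvd_prod_sub {k T ι : Type*} [Field k] [IsAlgClosed k] [CommRing T] [IsDomain T]
    [UniqueFactorizationMonoid T] [Algebra k T] [Algebra.FiniteType k T] (Δ : T →ₐ[k] T ⊗[k] T)
    (e : ι → T →ₐ[k] k) (he : ∀ h : T, (∀ i, e i h = 0) → h = 0) (f : T)
    (hf : ∀ i, ∀ P : Ideal T, P.IsPrime → f ∈ P →
      Algebra.TensorProduct.productMap ((Algebra.ofId k T).comp (e i)) (AlgHom.id k T) (Δ f) ∉ P)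
    (w : T) (hw : ∀ x y : T →ₐ[k] k, x f = 0 → y f = 0 → Associated
      (Algebra.TensorProduct.productMap (AlgHom.id k T) ((Algebra.ofId k T).comp x) (Δ f))
      (Algebra.TensorProduct.productMap (AlgHom.id k T) ((Algebra.ofId k T).comp y) (Δ f)) →
      x w = y w) :
    ∃ s : Multiset k, f ∣ (s.map fun v => w - algebraMap k T v).prod := by
  classical
  obtain ⟨h, h0, hh⟩ := exists_ne_zero_forall_translate_dvd Δ e he f hf
  let V : Set (T →ₐ[k] k) := {x | x f = 0}
  let c : (T →ₐ[k] k) → Associates T := fun x => Associates.mk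
    (Algebra.TensorProduct.productMap (AlgHom.id k T) ((Algebra.ofId k T).comp x) (Δ f))
  have hc : (c '' V).Finite := (finite_associates_dvd h0).subset (by
    rintro _ ⟨x, hx, rfl⟩
    exact Associates.mk_dvd_mk.2 (hh x hx))
  have hV : ((fun x : T →ₐ[k] k => x w) '' V).Finite := by
    rcases V.eq_empty_or_nonempty with hV | ⟨x₀, -⟩
    · simp [hV]
    have : Nonempty (T →ₐ[k] k) := ⟨x₀⟩
    refine (hc.image fun a => Function.invFunOn c V a w).subset ?_
    rintro _ ⟨x, hx, rfl⟩
    have hex : ∃ y ∈ V, c y = c x := ⟨x, hx, rfl⟩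
    refine ⟨c x, ⟨x, hx, rfl⟩, hw _ _ (Function.invFunOn_mem hex) hx ?_⟩
    exact Associates.mk_eq_mk_iff_associated.1 (Function.invFunOn_eq hex)
  obtain ⟨N, hN⟩ := exists_dvd_pow_of_forall_point f
    (∏ v ∈ hV.toFinset, (w - algebraMap k T v)) (fun (x : T →ₐ[k] k) hx => by
      rw [map_prod x (fun v => w - algebraMap k T v)]
      refine Finset.prod_eq_zero (i := x w) (by simpa using ⟨x, hx, rfl⟩) ?_
      simp)
  refine ⟨N • hV.toFinset.val, ?_⟩
  rwa [Multiset.map_nsmul, Multiset.prod_nsmul]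

theorem exists_isRoot_of_aeval_mem {k T : Type*} [Field k] [IsAlgClosed k] [CommRing T]
    [Algebra k T] {P : Ideal T} (hP : P.IsPrime) (w : T) {g : k[X]} (g0 : g ≠ 0)
    (hg : aeval w g ∈ P) : ∃ a, g.IsRoot a ∧ w - algebraMap k T a ∈ P := by
  rw [(IsAlgClosed.splits g).eq_prod_roots, map_mul, aeval_C] at hg
  rcases hP.mem_or_mem hg with h | h
  · refine absurd (P.eq_top_of_isUnit_mem h (IsUnit.map _ ?_)) hP.ne_top
    exact (leadingCoeff_ne_zero.2 g0).isUnit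
  · rw [map_multiset_prod, Multiset.map_map, hP.multiset_prod_mem_iff_exists_mem] at h
    obtain ⟨_, hq, hqP⟩ := h
    obtain ⟨a, ha, rfl⟩ := Multiset.mem_map.1 hq
    exact ⟨a, isRoot_of_mem_roots ha, by simpa using hqP⟩

/-! ### Factors of homogeneous elements -/

theorem AddMonoidAlgebra.exists_eq_single_of_mul_eq_single {A Q : Type*} [Semiring A]
    [NoZeroDivisors A] [Add Q] [TwoUniqueSums Q] {F G : AddMonoidAlgebra A Q} {q : Q} {c : A}
    (hc : c ≠ 0) (h : F * G = single q c) : ∃ p a, F = single p a := by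
  classical
  have hF : F.coeff.support.Nonempty := by
    rw [Finsupp.support_nonempty_iff]
    rintro h0
    rw [coeff_eq_zero.1 h0, zero_mul] at h
    exact hc (single_eq_zero.1 h.symm)
  have hG : G.coeff.support.Nonempty := by
    rw [Finsupp.support_nonempty_iff]
    rintro h0
    rw [coeff_eq_zero.1 h0, mul_zero] at h
    exact hc (single_eq_zero.1 h.symm)
  have key : ∀ r ∈ F.coeff.support ×ˢ G.coeff.support,
      UniqueAdd F.coeff.support G.coeff.support r.1 r.2 → r.1 + r.2 = q := by
    intro r hr hu
    have h1 := coeff_mul_add_of_uniqueAdd hu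
    rw [h] at h1
    by_contra hne
    rw [coeff_single, Finsupp.single_apply, if_neg (Ne.symm hne)] at h1
    rw [Finset.mem_product, Finsupp.mem_support_iff, Finsupp.mem_support_iff] at hr
    exact mul_ne_zero hr.1 hr.2 h1.symm
  rcases le_or_gt (F.coeff.support.card * G.coeff.support.card) 1 with hle | hlt
  · have : F.coeff.support.card ≤ 1 :=
      (Nat.le_mul_of_pos_right _ (Finset.card_pos.2 hG)).trans hle
    have : Nonempty Q := ⟨q⟩
    obtain ⟨p, a, hpa⟩ := Finsupp.card_support_le_one'.1 ‹_›
    exact ⟨p, a, coeff_injective hpa⟩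
  · obtain ⟨r, hr, s, hs, hrs, hur, hus⟩ := TwoUniqueSums.uniqueAdd_of_one_lt_card hlt
    have hs' := Finset.mem_product.1 hs
    have := hur hs'.1 hs'.2 ((key s hs hus).trans (key r hr hur).symm)
    exact absurd (Prod.ext this.1.symm this.2.symm) hrs

namespace LaurentRing

section Grading

variable {k : Type*} [CommRing k] {n : ℕ}

/-- The coaction of the grading of the Laurent ring in which the monomial with exponent `a` has
degree `φ a`. -/
def coaction (φ : (Fin n → ℤ) →+ (Fin n → ℤ)) :
    LaurentRing k n →ₐ[k] AddMonoidAlgebra (LaurentRing k n) (Fin n → ℤ) :=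
  AddMonoidAlgebra.lift k _ (Fin n → ℤ)
    { toFun := fun a => AddMonoidAlgebra.single (φ a.toAdd) (AddMonoidAlgebra.single a.toAdd 1)
      map_one' := by simp [AddMonoidAlgebra.one_def]
      map_mul' := fun a b => by simp [AddMonoidAlgebra.single_mul_single] }

theorem coaction_single (φ : (Fin n → ℤ) →+ (Fin n → ℤ)) (a : Fin n → ℤ) (c : k) :
    coaction φ (AddMonoidAlgebra.single a c) =
      AddMonoidAlgebra.single (φ a) (AddMonoidAlgebra.single a c) := by
  simp [coaction, AddMonoidAlgebra.lift_single]

theorem coeff_coeff_coaction (φ : (Fin n → ℤ) →+ (Fin n → ℤ)) (f : LaurentRing k n)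
    (a : Fin n → ℤ) : ((coaction φ f).coeff (φ a)).coeff a = f.coeff a := by
  classical
  induction f using AddMonoidAlgebra.induction_linear with
  | zero => simp
  | add f g hf hg => simp [hf, hg]
  | single b c =>
    rw [coaction_single, AddMonoidAlgebra.coeff_single, AddMonoidAlgebra.coeff_single,
      Finsupp.single_apply]
    split_ifs with h
    · rfl
    · have : b ≠ a := fun h' => h (h' ▸ rfl)
      simp [this]

end Grading

section Domain

variable {k : Type*} [Field k] {n : ℕ}

/-- A divisor of an element of degree `0` is homogeneous, as the degrees form a group with the
two-unique-sums property. -/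
theorem exists_forall_mem_support_eq {φ : (Fin n → ℤ) →+ (Fin n → ℤ)} {f h : LaurentRing k n}
    (h0 : h ≠ 0) (hh : coaction φ h = AddMonoidAlgebra.single 0 h) (hf : f ∣ h) :
    ∃ q, ∀ a ∈ f.coeff.support, φ a = q := by
  classical
  obtain ⟨g, rfl⟩ := hf
  rw [map_mul] at hh
  obtain ⟨q, c, hq⟩ := AddMonoidAlgebra.exists_eq_single_of_mul_eq_single h0 hh
  refine ⟨q, fun a ha => ?_⟩
  by_contra hne
  have := coeff_coeff_coaction φ f a
  rw [hq, AddMonoidAlgebra.coeff_single, Finsupp.single_apply, if_neg (Ne.symm hne)] at this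
  exact Finsupp.mem_support_iff.1 ha this.symm

theorem exists_eq_single_of_isUnit {u : LaurentRing k n} (hu : IsUnit u) :
    ∃ m c, c ≠ 0 ∧ u = AddMonoidAlgebra.single m c := by
  obtain ⟨v, hv⟩ := hu.exists_right_inv
  rw [AddMonoidAlgebra.one_def] at hv
  obtain ⟨m, c, rfl⟩ := AddMonoidAlgebra.exists_eq_single_of_mul_eq_single one_ne_zero hv
  exact ⟨m, c, fun h => hu.ne_zero (by simp [h]), rfl⟩

/-! ### The Laurent ring is factorial -/

instance : UniqueFactorizationMonoid (LaurentRing k n) := by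
  let c : (Fin n →₀ ℕ) →+ (Fin n → ℤ) :=
    { toFun := fun s i => (s i : ℤ)
      map_zero' := by ext; simp
      map_add' := fun s t => by ext; simp }
  have hc : Function.Injective c := fun s t h => by
    ext i
    exact Int.ofNat_inj.1 (congrFun h i)
  let ι : MvPolynomial (Fin n) k →+* LaurentRing k n := AddMonoidAlgebra.mapDomainRingHom k c
  have hι : Function.Injective ι := AddMonoidAlgebra.mapDomain_injective hc
  have hmon : ∀ s, ι (MvPolynomial.monomial s 1) = AddMonoidAlgebra.single (c s) 1 := fun s =>
    AddMonoidAlgebra.mapDomain_single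
  have hunit : ∀ s, IsUnit (AddMonoidAlgebra.single (c s) 1 : LaurentRing k n) := fun s =>
    (monomial (c s)).isUnit
  have hsurj : ∀ z : LaurentRing k n, ∃ s y, z * AddMonoidAlgebra.single (c s) 1 = ι y := by
    intro z
    induction z using AddMonoidAlgebra.induction_linear with
    | zero => exact ⟨0, 0, by simp⟩
    | add f g hf hg =>
      obtain ⟨s, y, h⟩ := hf
      obtain ⟨t, z, h'⟩ := hg
      refine ⟨s + t, y * MvPolynomial.monomial t 1 + z * MvPolynomial.monomial s 1, ?_⟩
      rw [map_add ι, map_mul, map_mul, ← h, ← h', hmon, hmon, map_add,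
        show (AddMonoidAlgebra.single (c s + c t) 1 : LaurentRing k n) =
          AddMonoidAlgebra.single (c s) 1 * AddMonoidAlgebra.single (c t) 1 by
          simp [AddMonoidAlgebra.single_mul_single]]
      ring
    | single a r =>
      refine ⟨Finsupp.equivFunOnFinite.symm fun i => (-a i).toNat,
        MvPolynomial.monomial (Finsupp.equivFunOnFinite.symm fun i => (a i).toNat) r, ?_⟩
      refine Eq.trans ?_ AddMonoidAlgebra.mapDomain_single.symm
      rw [AddMonoidAlgebra.single_mul_single, mul_one]
      congr 1
      ext i
      simp only [Pi.add_apply, c, AddMonoidHom.coe_mk, ZeroHom.coe_mk,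
        Finsupp.coe_equivFunOnFinite_symm]
      omega
  let L : ((IsUnit.submonoid (LaurentRing k n)).comap ι).LocalizationMap (LaurentRing k n) :=
    { ι with
      isLocalizationMap :=
        { map_units := fun y => y.2
          surj := fun z => by
            obtain ⟨s, y, h⟩ := hsurj z
            refine ⟨(y, ⟨MvPolynomial.monomial s 1, ?_⟩), ?_⟩
            · exact ((hmon s).symm ▸ hunit s : IsUnit (ι (MvPolynomial.monomial s 1)))
            · exact (congrArg (z * ·) (hmon s)).trans h
          exists_of_eq := fun {x y} h => ⟨1, by rw [hι h]⟩ } }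
  exact L.uniqueFactorizationMonoid

end Domain

end LaurentRing

/-! ### Translations of the torus -/

namespace LaurentRing

open TensorProduct

variable {k : Type*} [Field k] {n : ℕ}

theorem algHom_ext {S : Type*} [CommRing S] [Algebra k S] {φ ψ : LaurentRing k n →ₐ[k] S}
    (h : ∀ a, φ (AddMonoidAlgebra.single a 1) = ψ (AddMonoidAlgebra.single a 1)) : φ = ψ :=
  (AddMonoidAlgebra.lift k S (Fin n → ℤ)).symm.injective (MonoidHom.ext fun a => h a.toAdd)

/-- The translate of a Laurent polynomial by a `k`-point of the torus: the monomial with exponent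
`a` is multiplied by its value at the point. -/
def translateBy (x : LaurentRing k n →ₐ[k] k) : LaurentRing k n →ₐ[k] LaurentRing k n :=
  AddMonoidAlgebra.lift k _ (Fin n → ℤ)
    { toFun := fun a =>
        AddMonoidAlgebra.single a.toAdd (x (AddMonoidAlgebra.single a.toAdd 1))
      map_one' := by simp [← AddMonoidAlgebra.one_def]
      map_mul' := fun a b => by
        rw [AddMonoidAlgebra.single_mul_single, ← map_mul, AddMonoidAlgebra.single_mul_single]
        simp }

theorem translateBy_single (x : LaurentRing k n →ₐ[k] k) (a : Fin n → ℤ) (c : k) :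
    translateBy x (AddMonoidAlgebra.single a c) =
      AddMonoidAlgebra.single a (c * x (AddMonoidAlgebra.single a 1)) := by
  simp [translateBy, AddMonoidAlgebra.lift_single]

theorem coeff_translateBy (x : LaurentRing k n →ₐ[k] k) (f : LaurentRing k n) (a : Fin n → ℤ) :
    (translateBy x f).coeff a = f.coeff a * x (AddMonoidAlgebra.single a 1) := by
  classical
  induction f using AddMonoidAlgebra.induction_linear with
  | zero => simp
  | add f g hf hg => simp [hf, hg, add_mul]
  | single b c =>
    rw [translateBy_single, AddMonoidAlgebra.coeff_single, AddMonoidAlgebra.coeff_single,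
      Finsupp.single_apply, Finsupp.single_apply]
    split_ifs with h
    · rw [h]
    · rw [zero_mul]

theorem point_single_ne_zero (x : LaurentRing k n →ₐ[k] k) (a : Fin n → ℤ) :
    x (AddMonoidAlgebra.single a 1) ≠ 0 :=
  ((monomial a : (LaurentRing k n)ˣ).isUnit.map x).ne_zero

theorem translateBy_injective (x : LaurentRing k n →ₐ[k] k) :
    Function.Injective (translateBy x) := by
  intro f g h
  refine AddMonoidAlgebra.coeff_injective (Finsupp.ext fun a => ?_)
  refine mul_right_cancel₀ (point_single_ne_zero x a) ?_
  rw [← coeff_translateBy, ← coeff_translateBy, h]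

theorem comul_single (a : Fin n → ℤ) :
    Bialgebra.comulAlgHom k (LaurentRing k n) (AddMonoidAlgebra.single a 1) =
      AddMonoidAlgebra.single a 1 ⊗ₜ AddMonoidAlgebra.single a 1 := by
  simp

theorem productMap_left_comul (x : LaurentRing k n →ₐ[k] k) :
    (Algebra.TensorProduct.productMap ((Algebra.ofId k (LaurentRing k n)).comp x)
      (AlgHom.id k (LaurentRing k n))).comp (Bialgebra.comulAlgHom k (LaurentRing k n)) =
      translateBy x := by
  refine algHom_ext fun a => ?_
  rw [AlgHom.comp_apply, comul_single, Algebra.TensorProduct.productMap_apply_tmul,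
    translateBy_single]
  simp [Algebra.ofId_apply, AddMonoidAlgebra.single_mul_single]

theorem productMap_right_comul (x : LaurentRing k n →ₐ[k] k) :
    (Algebra.TensorProduct.productMap (AlgHom.id k (LaurentRing k n))
      ((Algebra.ofId k (LaurentRing k n)).comp x)).comp
        (Bialgebra.comulAlgHom k (LaurentRing k n)) = translateBy x := by
  refine algHom_ext fun a => ?_
  rw [AlgHom.comp_apply, comul_single, Algebra.TensorProduct.productMap_apply_tmul,
    translateBy_single]
  simp [Algebra.ofId_apply, AddMonoidAlgebra.single_mul_single]

theorem multiplier_add (q : Fin n → kˣ) (a b : Fin n → ℤ) :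
    multiplier q (a + b) = multiplier q a * multiplier q b := by
  simp [multiplier, zpow_add, Finset.prod_mul_distrib]

theorem multiplier_zpow (q : Fin n → kˣ) (i : ℤ) (a : Fin n → ℤ) :
    multiplier (q ^ i) a = multiplier q a ^ i := by
  simp [multiplier, ← Finset.prod_zpow, zpow_comm]

/-- Evaluation at the point `q` of the torus. -/
def evalAt (q : Fin n → kˣ) : LaurentRing k n →ₐ[k] k :=
  AddMonoidAlgebra.lift k _ (Fin n → ℤ)
    { toFun := fun a => multiplier q a.toAdd
      map_one' := by simp [multiplier]
      map_mul' := fun a b => by simp [multiplier_add] }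

theorem evalAt_single (q : Fin n → kˣ) (a : Fin n → ℤ) (c : k) :
    evalAt q (AddMonoidAlgebra.single a c) = c * multiplier q a := by
  simp [evalAt, AddMonoidAlgebra.lift_single]

theorem scale_zpow (p : Fin n → kˣ) (i : ℤ) :
    (scale p : LaurentRing k n ≃ₐ[k] LaurentRing k n) ^ i = scale (p ^ i) := by
  let Φ : (Fin n → kˣ) →* (LaurentRing k n ≃ₐ[k] LaurentRing k n) :=
    MonoidHom.mk' scale fun p q => by
      refine AlgEquiv.ext fun f => ?_
      change scaleHom (p * q) f = scaleHom p (scaleHom q f)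
      induction f using AddMonoidAlgebra.induction_linear with
      | zero => simp
      | add f g hf hg => simp only [map_add, hf, hg]
      | single a c =>
        rw [scaleHom_single, scaleHom_single, scaleHom_single]
        simp [multiplier, mul_zpow, Finset.prod_mul_distrib, mul_comm, mul_left_comm]
  exact (map_zpow Φ p i).symm

theorem scale_single (p : Fin n → kˣ) (a : Fin n → ℤ) (c : k) :
    scale p (AddMonoidAlgebra.single a c) = AddMonoidAlgebra.single a (c * multiplier p a) :=
  scaleHom_single p a c

theorem scale_eq_translateBy (p : Fin n → kˣ) :
    (scale p : LaurentRing k n →ₐ[k] LaurentRing k n) = translateBy (evalAt p) := by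
  refine algHom_ext fun a => ?_
  rw [translateBy_single, evalAt_single]
  exact (scale_single p a 1).trans (by simp)

theorem multiplier_injective {p : Fin n → kˣ}
    (hp : LinearIndependent ℤ (fun i => Additive.ofMul (p i))) :
    Function.Injective fun a => (multiplier p a : k) := by
  intro a b h
  have h' : multiplier p a = multiplier p b := Units.ext h
  have := Fintype.linearIndependent_iff.1 hp (a - b) (by
    have h1 : multiplier p (a - b) = 1 := by
      have := multiplier_add p (a - b) b
      rw [sub_add_cancel, h'] at this
      exact (mul_eq_right.1 this.symm)
    exact h1)
  exact funext fun i => sub_eq_zero.1 (this i)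

theorem evalAt_eq_sum (q : Fin n → kˣ) (f : LaurentRing k n) :
    evalAt q f = f.coeff.sum fun a c => c * multiplier q a := by
  conv_lhs => rw [← AddMonoidAlgebra.sum_coeff_single f]
  rw [map_finsuppSum]
  simp only [evalAt_single]

/-- The positive powers of a point with multiplicatively independent coordinates are Zariski dense
in the torus, by the independence of the characters `i ↦ (multiplier p a) ^ i`. -/
theorem eq_zero_of_forall_evalAt_pow {p : Fin n → kˣ}
    (hp : LinearIndependent ℤ (fun i => Additive.ofMul (p i))) {h : LaurentRing k n}
    (hh : ∀ i : ℕ, evalAt (p ^ ((i : ℤ) + 1)) h = 0) : h = 0 := by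
  have hli : LinearIndependent k fun a : Fin n → ℤ =>
      (⇑(powersHom k (multiplier p a : k)) : Multiplicative ℕ → k) := by
    refine (linearIndependent_monoidHom (Multiplicative ℕ) k).comp
      (fun a => powersHom k (multiplier p a : k)) fun a b hab => multiplier_injective hp ?_
    exact (powersHom k).injective hab
  have := linearIndependent_iff'.1 hli h.coeff.support
    (fun a => h.coeff a * multiplier p a) (by
      ext i
      have := hh i.toAdd
      rw [evalAt_eq_sum, Finsupp.sum] at this
      rw [Finset.sum_apply, Pi.zero_apply, ← this]
      refine Finset.sum_congr rfl fun a _ => ?_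
      rw [multiplier_zpow, zpow_add_one]
      simp only [Pi.smul_apply, smul_eq_mul, powersHom_apply, zpow_natCast, Units.val_mul,
        Units.val_pow_eq_pow_val]
      ring)
  refine AddMonoidAlgebra.coeff_injective (Finsupp.ext fun a => ?_)
  by_contra ha
  have := this a (Finsupp.mem_support_iff.2 ha)
  exact ha ((mul_eq_zero.1 this).resolve_right (Units.ne_zero _))

/-- A unit relating two elements with the same support is constant: it is a monomial, and its
exponent shifts the common support, which is finite. -/
theorem exists_eq_single_zero_of_support_eq {f g : LaurentRing k n} (g0 : g ≠ 0)
    {u : LaurentRing k n} (hu : IsUnit u) (h : f = u * g)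
    (hsupp : f.coeff.support = g.coeff.support) : ∃ c : k, u = AddMonoidAlgebra.single 0 c := by
  classical
  obtain ⟨m, c, hc, rfl⟩ := exists_eq_single_of_isUnit hu
  suffices m = 0 by exact ⟨c, by rw [this]⟩
  have hS : g.coeff.support.map (addLeftEmbedding m) = g.coeff.support := by
    ext a
    rw [← hsupp, Finset.mem_map]
    constructor
    · rintro ⟨b, hb, rfl⟩
      rw [hsupp, Finsupp.mem_support_iff] at hb
      rw [Finsupp.mem_support_iff, h]
      simpa [AddMonoidAlgebra.coeff_single_mul_apply] using ⟨hc, hb⟩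
    · intro ha
      refine ⟨-m + a, ?_, by simp⟩
      rw [hsupp, Finsupp.mem_support_iff]
      rw [Finsupp.mem_support_iff, h, AddMonoidAlgebra.coeff_single_mul_apply] at ha
      exact right_ne_zero_of_mul ha
  -- The sum over the support is unchanged by the shift, so `card • m = 0`.
  have hsum := congrArg (fun S : Finset (Fin n → ℤ) => ∑ a ∈ S, a) hS
  simp only [Finset.sum_map, addLeftEmbedding_apply] at hsum
  rw [Finset.sum_add_distrib, Finset.sum_const, add_eq_right] at hsum
  refine (smul_eq_zero.1 hsum).resolve_left ?_
  rw [Finset.card_eq_zero, Finsupp.support_eq_empty, AddMonoidAlgebra.coeff_eq_zero]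
  exact g0

theorem support_translateBy (x : LaurentRing k n →ₐ[k] k) (f : LaurentRing k n) :
    (translateBy x f).coeff.support = f.coeff.support := by
  ext a
  simp [coeff_translateBy, point_single_ne_zero]

/-- Associated translates by `x` and `y` differ by a scalar, and the monomials of `f` take
proportional values at `x` and `y`. -/
theorem exists_scalar_of_translateBy_eq {f : LaurentRing k n} (f0 : f ≠ 0)
    (x y : LaurentRing k n →ₐ[k] k) {u : LaurentRing k n} (hu : IsUnit u)
    (h : translateBy y f = u * translateBy x f) :
    ∃ c : k, u = AddMonoidAlgebra.single 0 c ∧ ∀ a ∈ f.coeff.support,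
      y (AddMonoidAlgebra.single a 1) = c * x (AddMonoidAlgebra.single a 1) := by
  obtain ⟨c, rfl⟩ := exists_eq_single_zero_of_support_eq
    ((map_ne_zero_iff _ (translateBy_injective x)).2 f0) hu h (by simp [support_translateBy])
  refine ⟨c, rfl, fun a ha => ?_⟩
  have := congrArg (fun F : LaurentRing k n => F.coeff a) h
  simp only [AddMonoidAlgebra.coeff_single_zero_mul, coeff_translateBy] at this
  refine mul_left_cancel₀ (Finsupp.mem_support_iff.1 ha) ?_
  rw [this]
  ring

theorem point_sub_eq_of_translateBy_eq {f : LaurentRing k n} (f0 : f ≠ 0)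
    (x y : LaurentRing k n →ₐ[k] k) {u : LaurentRing k n} (hu : IsUnit u)
    (h : translateBy y f = u * translateBy x f) {a b : Fin n → ℤ} (ha : a ∈ f.coeff.support)
    (hb : b ∈ f.coeff.support) :
    x (AddMonoidAlgebra.single (a - b) 1) = y (AddMonoidAlgebra.single (a - b) 1) := by
  obtain ⟨c, -, hc⟩ := exists_scalar_of_translateBy_eq f0 x y hu h
  have hsub : ∀ z : LaurentRing k n →ₐ[k] k, z (AddMonoidAlgebra.single (a - b) 1) *
      z (AddMonoidAlgebra.single b 1) = z (AddMonoidAlgebra.single a 1) := fun z => by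
    rw [← map_mul, AddMonoidAlgebra.single_mul_single, sub_add_cancel, mul_one]
  refine mul_right_cancel₀ (point_single_ne_zero y b) ?_
  rw [hsub, hc a ha, hc b hb, ← hsub x]
  ring

theorem exists_ne_of_not_isUnit {f : LaurentRing k n} (f0 : f ≠ 0) (hf : ¬ IsUnit f) :
    ∃ a ∈ f.coeff.support, ∃ b ∈ f.coeff.support, a - b ≠ 0 := by
  by_contra! h
  obtain ⟨a, ha⟩ : f.coeff.support.Nonempty := by
    rw [Finsupp.support_nonempty_iff]
    exact fun h => f0 (AddMonoidAlgebra.coeff_eq_zero.1 h)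
  refine hf ?_
  have : f = AddMonoidAlgebra.single a (f.coeff a) := by
    refine AddMonoidAlgebra.coeff_injective (Finsupp.ext fun b => ?_)
    by_cases hb : b ∈ f.coeff.support
    · rw [sub_eq_zero.1 (h b hb a ha)]
      simp
    · rw [Finsupp.notMem_support_iff.1 hb, AddMonoidAlgebra.coeff_single,
        Finsupp.single_eq_of_ne]
      exact fun h => hb (h ▸ ha)
  have hc := Finsupp.mem_support_iff.1 ha
  rw [this]
  exact IsUnit.of_mul_eq_one (AddMonoidAlgebra.single (-a) (f.coeff a)⁻¹)
    (by simp [AddMonoidAlgebra.single_mul_single, AddMonoidAlgebra.one_def, hc])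

end LaurentRing

/-! ### Loneliness and prime ideals -/

section Lonely

variable {k T : Type*} [CommRing k] [CommRing T] [Algebra k T]

theorem specAut_mul (σ τ : T ≃ₐ[k] T) : specAut (σ * τ) = specAut τ * specAut σ := by
  refine Iso.ext ?_
  change Spec.map _ = Spec.map _ ≫ Spec.map _
  rw [← Spec.map_comp]
  rfl

theorem specAut_zpow (σ : T ≃ₐ[k] T) (i : ℤ) : specAut σ ^ i = specAut (σ ^ i) := by
  let Φ : (T ≃ₐ[k] T)ᵐᵒᵖ →* Aut (Spec (CommRingCat.of T)) :=
    MonoidHom.mk' (fun s => specAut s.unop) fun s t => specAut_mul _ _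
  exact (map_zpow Φ (MulOpposite.op σ) i).symm

theorem isLonely_vanishing_iff (σ : T ≃ₐ[k] T) (f : T) :
    IsLonely (specAut σ) (vanishing f) ↔
      ∀ i : ℤ, i ≠ 0 → ∀ P : Ideal T, P.IsPrime → f ∈ P → (σ ^ i) f ∉ P := by
  have hmem : ∀ Q : PrimeSpectrum T, Q ∈ ((vanishing f : TopologicalSpace.Closeds _) :
      Set (Spec (CommRingCat.of T))) ↔
      f ∈ Q.asIdeal := fun Q => by
    change Q ∈ PrimeSpectrum.zeroLocus {f} ↔ _
    simp [PrimeSpectrum.mem_zeroLocus]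
  constructor
  · intro h i hi P hP hf hσ
    have h1 := h (-i) (neg_ne_zero.2 hi)
    rw [specAut_zpow] at h1
    refine Set.eq_empty_iff_forall_notMem.1 h1 ⟨P, hP⟩ ⟨(hmem _).2 hf, ?_⟩
    refine ⟨(⟨P.comap ((σ ^ i : T ≃ₐ[k] T) : T →+* T), hP.comap _⟩ : PrimeSpectrum T),
      (hmem _).2 hσ, ?_⟩
    refine PrimeSpectrum.ext (Ideal.ext fun t => ?_)
    change (σ ^ i) ((σ ^ (-i)) t) ∈ P ↔ t ∈ P
    rw [← AlgEquiv.mul_apply, ← zpow_add, add_neg_cancel, zpow_zero, AlgEquiv.one_apply]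
  · intro h i hi
    rw [specAut_zpow]
    refine Set.eq_empty_iff_forall_notMem.2 ?_
    rintro _ ⟨hf, Q, hQ, rfl⟩
    refine h (-i) (neg_ne_zero.2 hi) (Ideal.comap ((σ ^ i : T ≃ₐ[k] T) : T →+* T)
      (PrimeSpectrum.asIdeal Q)) (Q.isPrime.comap _) ((hmem _).1 hf) ?_
    change (σ ^ i) ((σ ^ (-i)) f) ∈ PrimeSpectrum.asIdeal Q
    rw [← AlgEquiv.mul_apply, ← zpow_add, add_neg_cancel, zpow_zero, AlgEquiv.one_apply]
    exact (hmem Q).1 hQ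

end Lonely

/-! ### Roots of polynomials in one element -/

section Forms

variable {k T : Type*} [Field k] [CommRing T] [Algebra k T]

theorem AlgHom.map_laurentEval₂ {S : Type*} [CommRing S] [Algebra k S] (φ : T →ₐ[k] S) (z : Tˣ)
    (g : LaurentPolynomial k) :
    φ (LaurentPolynomial.eval₂ (algebraMap k T) z g) =
      LaurentPolynomial.eval₂ (algebraMap k S) (Units.map (φ : T →* S) z) g := by
  induction g using LaurentPolynomial.induction_on' with
  | add p q hp hq => rw [map_add, map_add, map_add, hp, hq]
  | C_mul_T m a =>
    rw [LaurentPolynomial.eval₂_C_mul_T, LaurentPolynomial.eval₂_C_mul_T, map_mul, φ.commutes,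
      ← map_zpow]
    rfl

theorem AlgHom.map_laurentEval₂_self (φ : T →ₐ[k] k) (z : Tˣ) (g : LaurentPolynomial k) :
    φ (LaurentPolynomial.eval₂ (algebraMap k T) z g) =
      LaurentPolynomial.eval₂ (RingHom.id k) (Units.map (φ : T →* k) z) g :=
  φ.map_laurentEval₂ z g

/-- A prime containing `g(z)` contains `z - a` for some root `a ≠ 0` of `g`. -/
theorem exists_laurent_root_of_eval₂_mem [IsAlgClosed k] {P : Ideal T} (hP : P.IsPrime) (z : Tˣ)
    {g : LaurentPolynomial k} (g0 : g ≠ 0)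
    (hg : LaurentPolynomial.eval₂ (algebraMap k T) z g ∈ P) :
    ∃ a : kˣ, LaurentPolynomial.eval₂ (RingHom.id k) a g = 0 ∧
      (z : T) - algebraMap k T a ∈ P := by
  obtain ⟨N, g', hg'⟩ := LaurentPolynomial.exists_T_pow g
  have hg'0 : g' ≠ 0 := by
    rintro rfl
    rw [map_zero] at hg'
    exact g0 (((LaurentPolynomial.isUnit_T N).mul_left_eq_zero).1 hg'.symm)
  obtain ⟨a, ha, haP⟩ := exists_isRoot_of_aeval_mem hP (z : T) hg'0 (by
    rw [aeval_def, ← LaurentPolynomial.eval₂_toLaurent, hg', map_mul]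
    exact P.mul_mem_right _ hg)
  have ha0 : a ≠ 0 := by
    rintro rfl
    rw [map_zero, sub_zero] at haP
    exact hP.ne_top (P.eq_top_of_isUnit_mem haP z.isUnit)
  refine ⟨Units.mk0 a ha0, ?_, haP⟩
  have h1 : LaurentPolynomial.eval₂ (RingHom.id k) (Units.mk0 a ha0) (toLaurent g') = 0 := by
    rw [LaurentPolynomial.eval₂_toLaurent]
    simpa [IsRoot.def] using ha
  rw [hg', map_mul, LaurentPolynomial.eval₂_T] at h1
  exact (mul_eq_zero.1 h1).resolve_right (Units.ne_zero _)

theorem algebraMap_mem_iff {P : Ideal T} (hP : P.IsPrime) {a : k} :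
    algebraMap k T a ∈ P ↔ a = 0 := by
  refine ⟨fun h => ?_, fun h => by simp [h]⟩
  by_contra h0
  exact hP.ne_top (P.eq_top_of_isUnit_mem h ((IsUnit.mk0 a h0).map _))

/-- A prime containing `f` and `σ f` would contain `x - a` and `σ x - b` for roots `a` and `b`. -/
theorem AdditiveForm.notMem_of_isPrime [IsAlgClosed k] [CharZero k] {x f : T} (u : Tˣ) (f0 : f ≠ 0)
    (hf : AdditiveForm k x (u * f)) {σ : T ≃ₐ[k] T} {i : ℤ} (hi : i ≠ 0)
    (hσ : σ x = x + i) {P : Ideal T} (hP : P.IsPrime) (hfP : f ∈ P) : σ f ∉ P := by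
  intro hσP
  obtain ⟨g, hg, hroots⟩ := hf
  have g0 : g ≠ 0 := by
    rintro rfl
    rw [map_zero] at hg
    exact f0 (u.mul_right_eq_zero.1 hg)
  obtain ⟨a, ha, haP⟩ := exists_isRoot_of_aeval_mem hP x g0 (hg ▸ P.mul_mem_left _ hfP)
  obtain ⟨b, hb, hbP⟩ := exists_isRoot_of_aeval_mem hP (σ x) g0 (by
    have : aeval (σ x) g = σ (aeval x g) := (aeval_algHom_apply σ x g)
    rw [this, ← hg, map_mul]
    exact P.mul_mem_left _ hσP)
  have hab : b - a = i := by
    have h := P.sub_mem haP hbP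
    rw [hσ] at h
    have : x - algebraMap k T a - (x + i - algebraMap k T b) = algebraMap k T (b - a - i) := by
      simp only [map_sub, map_intCast]
      ring
    rw [this, algebraMap_mem_iff hP] at h
    exact sub_eq_zero.1 h
  refine hroots b a hb ha (fun h => hi ?_) i hab
  rw [h, sub_self] at hab
  exact_mod_cast hab.symm

/-- A prime containing `f` and `σ f` would contain `z - a` and `σ z - b` for roots `a` and `b`. -/
theorem MultiplicativeForm.notMem_of_isPrime [IsAlgClosed k] {z : Tˣ} {ρ : kˣ} {f : T} (u : Tˣ)
    (f0 : f ≠ 0) (hfu : ¬ IsUnit f) (hf : MultiplicativeForm z ρ (u * f)) {σ : T ≃ₐ[k] T} {i : ℤ}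
    (hz : z = 1 ∨ ρ ^ i ≠ 1) (hσ : σ z = algebraMap k T ((ρ ^ i : kˣ) : k) * z) {P : Ideal T}
    (hP : P.IsPrime) (hfP : f ∈ P) : σ f ∉ P := by
  intro hσP
  obtain ⟨g, hg, hroots⟩ := hf
  have g0 : g ≠ 0 := by
    rintro rfl
    rw [map_zero] at hg
    exact f0 (u.mul_right_eq_zero.1 hg)
  rcases hz with rfl | hρ
  · -- Evaluation at `z = 1` makes `u * f` a constant, which is zero or a unit.
    have h1 := (Algebra.ofId k T).map_laurentEval₂ 1 g
    rw [map_one] at h1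
    change algebraMap k T _ = LaurentPolynomial.eval₂ (algebraMap k T) 1 g at h1
    rw [← hg] at h1
    by_cases hc : LaurentPolynomial.eval₂ (algebraMap k k) 1 g = 0
    · rw [hc, map_zero] at h1
      exact f0 (u.mul_right_eq_zero.1 h1.symm)
    · exact hfu ((Units.isUnit_units_mul u f).1 (h1 ▸ (IsUnit.mk0 _ hc).map (algebraMap k T)))
  · obtain ⟨a, ha, haP⟩ := exists_laurent_root_of_eval₂_mem hP z g0 (hg ▸ P.mul_mem_left _ hfP)
    obtain ⟨b, hb, hbP⟩ := exists_laurent_root_of_eval₂_mem hP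
      (Units.map ((σ : T →ₐ[k] T) : T →* T) z) g0 (by
        rw [← AlgHom.map_laurentEval₂, ← hg, map_mul]
        exact P.mul_mem_left _ hσP)
    have hab : b = ρ ^ i * a := by
      have h := P.sub_mem (P.mul_mem_left (algebraMap k T ((ρ ^ i : kˣ) : k)) haP) hbP
      have h2 : ((Units.map ((σ : T →ₐ[k] T) : T →* T) z : Tˣ) : T) = σ z := rfl
      rw [h2, hσ] at h
      have : algebraMap k T ((ρ ^ i : kˣ) : k) * (z - algebraMap k T a) -
          (algebraMap k T ((ρ ^ i : kˣ) : k) * z - algebraMap k T b) =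
          algebraMap k T (b - (ρ ^ i : kˣ) * a) := by
        simp only [map_sub, map_mul]
        ring
      rw [this, algebraMap_mem_iff hP] at h
      exact Units.ext (sub_eq_zero.1 h)
    refine hroots b a hb ha (fun h => hρ ?_) i (by rw [hab, mul_div_cancel_right])
    rw [h] at hab
    exact (mul_eq_right.1 hab.symm)

theorem additiveForm_of_forall_notMem {x f : T} {u : Tˣ} {g : k[X]} (hg : u * f = aeval x g)
    {σ : T ≃ₐ[k] T} (hσ : ∀ i : ℤ, (σ ^ i) x = x + i) (hx : ∀ a : k, ∃ y : T →ₐ[k] k, y x = a)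
    (hf : ∀ i : ℤ, i ≠ 0 → ∀ P : Ideal T, P.IsPrime → f ∈ P → (σ ^ i) f ∉ P) :
    AdditiveForm k x (u * f) := by
  refine ⟨g, hg, fun a b ha hb hab i hi => ?_⟩
  obtain ⟨y, hy⟩ := hx b
  have hunit : ∀ τ : T →ₐ[k] T, y (τ (u * f)) = 0 → τ f ∈ RingHom.ker y := fun τ h => by
    rw [map_mul, map_mul] at h
    exact (mul_eq_zero.1 h).resolve_left ((u.isUnit.map τ).map y).ne_zero
  refine hf i (fun h => hab ?_) (RingHom.ker y) (RingHom.ker_isPrime _)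
    (hunit (AlgHom.id k T) ?_) (hunit ((σ ^ i : T ≃ₐ[k] T) : T →ₐ[k] T) ?_)
  · rw [h, Int.cast_zero] at hi
    exact sub_eq_zero.1 hi
  · rw [AlgHom.id_apply, hg, ← aeval_algHom_apply, hy]
    exact hb
  · rw [hg, ← aeval_algHom_apply, ← aeval_algHom_apply]
    change aeval (y ((σ ^ i) x)) g = 0
    rw [hσ, map_add, hy, map_intCast, ← hi, add_sub_cancel]
    exact ha

theorem multiplicativeForm_of_forall_notMem {z : Tˣ} {ρ : kˣ} {f : T} {u : Tˣ}
    {g : LaurentPolynomial k} (hg : u * f = LaurentPolynomial.eval₂ (algebraMap k T) z g)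
    {σ : T ≃ₐ[k] T} (hσ : ∀ i : ℤ, (σ ^ i) z = algebraMap k T ((ρ ^ i : kˣ) : k) * z)
    (hz : ∀ a : kˣ, ∃ y : T →ₐ[k] k, y z = a)
    (hf : ∀ i : ℤ, i ≠ 0 → ∀ P : Ideal T, P.IsPrime → f ∈ P → (σ ^ i) f ∉ P) :
    MultiplicativeForm z ρ (u * f) := by
  refine ⟨g, hg, fun a b ha hb hab i hi => ?_⟩
  obtain ⟨y, hy⟩ := hz b
  have hunit : ∀ τ : T →ₐ[k] T, y (τ (u * f)) = 0 → τ f ∈ RingHom.ker y := fun τ h => by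
    rw [map_mul, map_mul] at h
    exact (mul_eq_zero.1 h).resolve_left ((u.isUnit.map τ).map y).ne_zero
  refine hf i (fun h => hab ?_) (RingHom.ker y) (RingHom.ker_isPrime _)
    (hunit (AlgHom.id k T) ?_) (hunit ((σ ^ i : T ≃ₐ[k] T) : T →ₐ[k] T) ?_)
  · rwa [h, zpow_zero, div_eq_one] at hi
  · rw [AlgHom.id_apply, hg, y.map_laurentEval₂_self]
    rwa [show Units.map (y : T →* k) z = b from Units.ext hy]
  · rw [hg, AlgHom.map_laurentEval₂, y.map_laurentEval₂_self]
    rwa [show Units.map (y : T →* k)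
      (Units.map (((σ ^ i : T ≃ₐ[k] T) : T →ₐ[k] T) : T →* T) z) = a from Units.ext ?_]
    change y ((σ ^ i) z) = a
    rw [hσ, map_mul, hy, y.commutes, ← hi]
    simp

end Forms

/-! ### Divisors of polynomials in a monomial -/

namespace LaurentRing

variable {k : Type*} [Field k] {n : ℕ}

/-- A nonzero vector is an integer multiple of a primitive vector `b'`; by Bézout, some linear form
`l` takes the value `1` at `b'`. -/
theorem exists_primitive (b : Fin n → ℤ) (hb : b ≠ 0) :
    ∃ (b' : Fin n → ℤ) (l : (Fin n → ℤ) →+ ℤ) (d : ℤ), l b' = 1 ∧ b = d • b' := by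
  let I : Ideal ℤ := Ideal.span (Set.range b)
  obtain ⟨d, hd⟩ : ∃ d, I = Ideal.span {d} := ⟨_, (Ideal.span_singleton_generator I).symm⟩
  have hdvd : ∀ i, d ∣ b i := fun i =>
    Ideal.mem_span_singleton.1 (hd ▸ Ideal.subset_span (Set.mem_range_self i))
  choose b' hb' using hdvd
  have hd0 : d ≠ 0 := by
    rintro rfl
    exact hb (funext fun i => by simp [hb' i])
  have hmem : d ∈ I := hd ▸ Ideal.mem_span_singleton_self d
  obtain ⟨c, hc⟩ := Ideal.mem_span_range_iff_exists_fun.1 hmem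
  refine ⟨b', ∑ i, (AddMonoidHom.mulLeft (c i)).comp (Pi.evalAddMonoidHom _ i), d, ?_,
    funext hb'⟩
  refine mul_left_cancel₀ hd0 ?_
  rw [mul_one]
  conv_rhs => rw [← hc]
  simp only [AddMonoidHom.finsetSum_apply, AddMonoidHom.comp_apply, Pi.evalAddMonoidHom_apply,
    AddMonoidHom.coe_mulLeft, Finset.mul_sum]
  exact Finset.sum_congr rfl fun i _ => by rw [hb' i]; ring

/-- Given `l b' = 1`, grade the Laurent ring by `a ↦ a - l a • b'`. The monomials of degree `0` are
the powers of that with exponent `b'`, so polynomials in such a power are homogeneous of degree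
`0`. Then their divisors are homogeneous too: each is a monomial times a Laurent polynomial in the
monomial with exponent `b'`. -/
theorem exists_eq_eval₂_of_dvd_prod {b' : Fin n → ℤ} {l : (Fin n → ℤ) →+ ℤ} {d : ℤ}
    (hl : l b' = 1) (hd : d • b' ≠ 0) {f : LaurentRing k n} {s : Multiset k} (f0 : f ≠ 0)
    (hf : f ∣ (s.map fun v => AddMonoidAlgebra.single (d • b') 1 -
      algebraMap k (LaurentRing k n) v).prod) :
    ∃ (u : (LaurentRing k n)ˣ) (g : LaurentPolynomial k),
      u * f = LaurentPolynomial.eval₂ (algebraMap k (LaurentRing k n)) (monomial b') g := by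
  classical
  let φ : (Fin n → ℤ) →+ (Fin n → ℤ) := AddMonoidHom.mk' (fun a => a - l a • b') fun a c => by
    simp only [map_add, add_smul]
    abel
  have hφ : φ (d • b') = 0 := by
    change d • b' - l (d • b') • b' = 0
    rw [map_zsmul, hl, smul_eq_mul, mul_one, sub_self]
  have hfac : ∀ v : k, (AddMonoidAlgebra.single (d • b') 1 - algebraMap k (LaurentRing k n) v) ≠ 0
      := fun v h => by
    rcases AddMonoidAlgebra.single_inj.1 (sub_eq_zero.1 h) with h | h
    · exact hd h.1
    · exact one_ne_zero h.1
  have h0 : (s.map fun v => AddMonoidAlgebra.single (d • b') 1 -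
      algebraMap k (LaurentRing k n) v).prod ≠ 0 := by
    intro h
    obtain ⟨v, -, hv⟩ := Multiset.mem_map.1 (Multiset.prod_eq_zero_iff.1 h)
    exact hfac v hv
  have hhom : coaction φ (s.map fun v => AddMonoidAlgebra.single (d • b') 1 -
      algebraMap k (LaurentRing k n) v).prod = AddMonoidAlgebra.single 0
        (s.map fun v => AddMonoidAlgebra.single (d • b') 1 -
          algebraMap k (LaurentRing k n) v).prod := by
    have hz : ∀ F : LaurentRing k n, (AddMonoidAlgebra.single 0 F :
        AddMonoidAlgebra (LaurentRing k n) (Fin n → ℤ)) =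
          AddMonoidAlgebra.singleZeroRingHom F := fun F => rfl
    rw [hz, map_multiset_prod, map_multiset_prod,
      Multiset.map_map, Multiset.map_map]
    refine congrArg Multiset.prod (Multiset.map_congr rfl fun v _ => ?_)
    simp only [Function.comp_apply, map_sub, coaction_single, hφ, AlgHom.commutes]
    rfl
  obtain ⟨q, hq⟩ := exists_forall_mem_support_eq h0 hhom hf
  obtain ⟨m, hm⟩ : f.coeff.support.Nonempty := by
    rw [Finsupp.support_nonempty_iff]
    exact fun h => f0 (AddMonoidAlgebra.coeff_eq_zero.1 h)
  refine ⟨(monomial m)⁻¹, AddMonoidAlgebra.mapDomain (fun a => l (a - m)) f, ?_⟩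
  rw [Units.inv_mul_eq_iff_eq_mul]
  have key : ∀ F : LaurentRing k n, ((monomial m : (LaurentRing k n)ˣ) : LaurentRing k n) *
      LaurentPolynomial.eval₂ (algebraMap k (LaurentRing k n)) (monomial b')
        (AddMonoidAlgebra.mapDomain (fun a => l (a - m)) F) =
      AddMonoidAlgebra.mapDomain (fun a => m + l (a - m) • b') F := fun F => by
    induction F using AddMonoidAlgebra.induction_linear with
    | zero => simp
    | add F G hF hG =>
      rw [AddMonoidAlgebra.mapDomain_add, AddMonoidAlgebra.mapDomain_add, map_add, mul_add, hF, hG]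
    | single a c =>
      have hz : ∀ j : ℤ, (monomial b' : (LaurentRing k n)ˣ) ^ j = monomial (j • b') := fun j => by
        let ψ : (Fin n → ℤ) →+ Additive (LaurentRing k n)ˣ :=
          AddMonoidHom.mk' (fun a => Additive.ofMul (monomial a)) monomial_add
        exact (map_zsmul ψ j b').symm
      rw [AddMonoidAlgebra.mapDomain_single, AddMonoidAlgebra.mapDomain_single]
      erw [LaurentPolynomial.single_eq_C_mul_T]
      rw [LaurentPolynomial.eval₂_C_mul_T, hz]
      simp [monomial, AddMonoidAlgebra.single_mul_single]
  rw [key]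
  refine AddMonoidAlgebra.coeff_injective ?_
  refine Eq.trans ?_ (Finsupp.mapDomain_congr (g := id) fun a ha => ?_).symm
  · exact Finsupp.mapDomain_id.symm
  · have h1 : a - l a • b' = m - l m • b' := (hq a ha).trans (hq m hm).symm
    rw [map_sub, sub_smul, id]
    linear_combination -h1

end LaurentRing

/-! ### Hypersurfaces in the torus -/

namespace LaurentRing

variable {k : Type*} [Field k] {n : ℕ}

theorem exists_point_monomial {b : Fin n → ℤ} {l : (Fin n → ℤ) →+ ℤ} (hl : l b = 1) (c : kˣ) :
    ∃ y : LaurentRing k n →ₐ[k] k, y (monomial b : (LaurentRing k n)ˣ) = c := by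
  refine ⟨AddMonoidAlgebra.lift k k (Fin n → ℤ)
    ((Units.coeHom k).comp ((zpowersHom kˣ c).comp l.toMultiplicative)), ?_⟩
  change AddMonoidAlgebra.lift k k (Fin n → ℤ) _ (AddMonoidAlgebra.single b 1) = _
  rw [AddMonoidAlgebra.lift_single]
  simp [hl]

theorem scale_zpow_monomial (p : Fin n → kˣ) (i : ℤ) (a : Fin n → ℤ) :
    ((scale p : LaurentRing k n ≃ₐ[k] LaurentRing k n) ^ i) (monomial a : (LaurentRing k n)ˣ) =
      algebraMap k (LaurentRing k n) ((multiplier p a ^ i : kˣ) : k) *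
        (monomial a : (LaurentRing k n)ˣ) := by
  rw [scale_zpow, ← multiplier_zpow]
  change scale _ (AddMonoidAlgebra.single a 1) = _ * AddMonoidAlgebra.single a 1
  rw [scale_single]
  simp [AddMonoidAlgebra.single_mul_single]

theorem monomial_eq_one_or_multiplier_zpow_ne_one {p : Fin n → kˣ}
    (hp : LinearIndependent ℤ (fun i => Additive.ofMul (p i))) (a : Fin n → ℤ) {i : ℤ}
    (hi : i ≠ 0) : (monomial a : (LaurentRing k n)ˣ) = 1 ∨ multiplier p a ^ i ≠ 1 := by
  rw [or_iff_not_imp_right, not_not]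
  intro h
  have h1 : multiplier p (i • a) = multiplier p 0 := by
    rw [show multiplier p (i • a) = multiplier p a ^ i by
      simp [multiplier, ← Finset.prod_zpow, zpow_mul, zpow_comm], h]
    simp [multiplier]
  have h2 : i • a = 0 := multiplier_injective hp (congrArg Units.val h1)
  have h3 : a = 0 := (smul_eq_zero.1 h2).resolve_left hi
  subst h3
  exact Units.ext (by simp [monomial, AddMonoidAlgebra.one_def])

/-- The quotient of two distinct monomials of `f` takes finitely many values on `V(f)`, so `f`
divides a product of elements `z ^ d - v` for one primitive monomial `z`. -/
theorem exists_form_of_forall_notMem [IsAlgClosed k] {p : Fin n → kˣ}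
    (hp : LinearIndependent ℤ (fun i => Additive.ofMul (p i))) {f : LaurentRing k n}
    (f0 : f ≠ 0) (hfu : ¬ IsUnit f)
    (hf : ∀ i : ℤ, i ≠ 0 → ∀ P : Ideal (LaurentRing k n), P.IsPrime → f ∈ P →
      (scale p ^ i) f ∉ P) :
    ∃ (u : (LaurentRing k n)ˣ) (a : Fin n → ℤ),
      MultiplicativeForm (monomial a : (LaurentRing k n)ˣ) (multiplier p a)
        ((u : LaurentRing k n) * f) := by
  obtain ⟨a, ha, b, hb, hab⟩ := exists_ne_of_not_isUnit f0 hfu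
  obtain ⟨s, hs⟩ := exists_dvd_prod_sub (Bialgebra.comulAlgHom k (LaurentRing k n))
    (fun i : ℕ => evalAt (p ^ ((i : ℤ) + 1))) (fun h => eq_zero_of_forall_evalAt_pow hp) f
    (fun i P hP hfP => by
      have := hf (i + 1) (by omega) P hP hfP
      rw [scale_zpow] at this
      rwa [← AlgHom.comp_apply, productMap_left_comul, ← scale_eq_translateBy])
    (AddMonoidAlgebra.single (a - b) 1) (fun x y _ _ h => by
      rw [← AlgHom.comp_apply, productMap_right_comul, ← AlgHom.comp_apply,
        productMap_right_comul] at h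
      obtain ⟨u, hu⟩ := h
      exact point_sub_eq_of_translateBy_eq f0 x y u.isUnit (by rw [← hu, mul_comm]) ha hb)
  obtain ⟨b', l, d, hl, hd⟩ := exists_primitive (a - b) hab
  rw [hd] at hs hab
  obtain ⟨u, g, hg⟩ := exists_eq_eval₂_of_dvd_prod hl hab f0 hs
  exact ⟨u, b', multiplicativeForm_of_forall_notMem hg
    (fun i => scale_zpow_monomial p i b') (exists_point_monomial hl) hf⟩

theorem isLonely_iff [IsAlgClosed k] {p : Fin n → kˣ}
    (hp : LinearIndependent ℤ (fun i => Additive.ofMul (p i))) {f : LaurentRing k n}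
    (f0 : f ≠ 0) (hfu : ¬ IsUnit f) :
    IsLonely (specAut (scale p)) (vanishing f) ↔
      ∃ (u : (LaurentRing k n)ˣ) (a : Fin n → ℤ),
        MultiplicativeForm (monomial a : (LaurentRing k n)ˣ) (multiplier p a)
          ((u : LaurentRing k n) * f) := by
  rw [isLonely_vanishing_iff]
  refine ⟨exists_form_of_forall_notMem hp f0 hfu, ?_⟩
  rintro ⟨u, a, h⟩ i hi P hP hfP
  exact h.notMem_of_isPrime u f0 hfu (monomial_eq_one_or_multiplier_zpow_ne_one hp a hi)
    (scale_zpow_monomial p i a) hP hfP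

end LaurentRing

/-! ### Exponential polynomials -/

section ExponentialPolynomials

variable {K : Type*} [Field K]

/-- The shift operator on sequences. -/
def shift (K : Type*) [Field K] : Module.End K (ℕ → K) := LinearMap.funLeft K K Nat.succ

theorem shift_sub_smul_exponential (c : K) (q : K[X]) :
    (shift K - c • (1 : Module.End K (ℕ → K))) (fun i => q.eval (i + 1 : K) * c ^ (i + 1)) =
      fun i : ℕ => (c • (taylor 1 q - q)).eval (i + 1 : K) * c ^ (i + 1) := by
  ext i
  simp only [shift, LinearMap.sub_apply, LinearMap.smul_apply, Module.End.one_apply, Pi.sub_apply,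
    Pi.smul_apply, LinearMap.funLeft_apply, smul_eq_mul, eval_smul, eval_sub, taylor_eval,
    Nat.succ_eq_add_one, Nat.cast_add, Nat.cast_one, pow_succ]
  ring

theorem exponential_mem_maxGenEigenspace (c : K) (q : K[X]) :
    (fun i : ℕ => q.eval (i + 1 : K) * c ^ (i + 1)) ∈ (shift K).maxGenEigenspace c := by
  obtain ⟨N, hN⟩ : ∃ N : ℕ, q.degree < N := ⟨q.natDegree + 1, by
    refine degree_le_natDegree.trans_lt ?_
    exact_mod_cast Nat.lt_succ_self _⟩
  induction N generalizing q with
  | zero =>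
    have : q = 0 := degree_eq_bot.1 (by simpa using hN)
    subst this
    convert ((shift K).maxGenEigenspace c).zero_mem using 1
    ext i
    simp
  | succ N ih =>
    rcases eq_or_ne q 0 with rfl | q0
    · convert ((shift K).maxGenEigenspace c).zero_mem using 1
      ext i
      simp
    have hdeg : (c • (taylor 1 q - q)).degree < N := by
      refine (degree_smul_le _ _).trans_lt ?_
      refine (degree_sub_lt_left (degree_taylor q 1) (by simpa using q0)
        (leadingCoeff_taylor 1 q)).trans_le ?_
      rw [degree_taylor]
      rw [degree_eq_natDegree q0] at hN ⊢
      exact_mod_cast Nat.lt_succ_iff.1 (by exact_mod_cast hN)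
    obtain ⟨m, hm⟩ := (Module.End.mem_maxGenEigenspace _ _ _).1 (ih _ hdeg)
    refine (Module.End.mem_maxGenEigenspace _ _ _).2 ⟨m + 1, ?_⟩
    rw [pow_succ, Module.End.mul_apply, shift_sub_smul_exponential, hm]

/-- The sequences `i ↦ q(i) c ^ i` with distinct `c` are independent, as they lie in different
generalized eigenspaces of the shift. -/
theorem eq_zero_of_forall_sum_exponential_eq_zero [CharZero K] {α : Type*} (S : Finset α)
    (c : α → K) (hc : Function.Injective c) (hc0 : ∀ a, c a ≠ 0) (q : α → K[X])
    (h : ∀ i : ℕ, ∑ a ∈ S, (q a).eval (i + 1 : K) * c a ^ (i + 1) = 0) {a : α} (ha : a ∈ S) :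
    q a = 0 := by
  have hind := (shift K).independent_maxGenEigenspace.comp hc
  have hz := (iSupIndep_iff_finsetSum_eq_zero_imp_eq_zero _).1 hind S
    (fun a => fun i : ℕ => (q a).eval (i + 1 : K) * c a ^ (i + 1))
    (fun a _ => exponential_mem_maxGenEigenspace (c a) (q a)) (by
      ext i
      simpa using h i) a ha
  refine eq_zero_of_infinite_isRoot _ (Set.infinite_of_injective_forall_mem
    (f := fun i : ℕ => (i + 1 : K)) (fun i j hij => by simpa using hij) fun i => ?_)
  exact (mul_eq_zero.1 (congrFun hz i)).resolve_right (pow_ne_zero _ (hc0 a))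

end ExponentialPolynomials

/-! ### Translations of the product of the line and the torus -/

namespace MixedRing

open TensorProduct LaurentRing

variable {k : Type*} [Field k] {n : ℕ}

theorem algHom_ext {S : Type*} [CommRing S] [Algebra k S] {φ ψ : MixedRing k n →ₐ[k] S}
    (hC : ∀ r : LaurentRing k n, φ (C r) = ψ (C r)) (hX : φ X = ψ X) : φ = ψ :=
  Polynomial.algHom_ext' (AlgHom.ext hC) hX

/-- The comultiplication of the product of the additive group and the torus. -/
def comul : MixedRing k n →ₐ[k] MixedRing k n ⊗[k] MixedRing k n :=
  aevalTower ((Algebra.TensorProduct.map (CAlgHom (R := k) (A := LaurentRing k n))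
    (CAlgHom (R := k) (A := LaurentRing k n))).comp (Bialgebra.comulAlgHom k (LaurentRing k n)))
    ((X : MixedRing k n) ⊗ₜ[k] (1 : MixedRing k n) + (1 : MixedRing k n) ⊗ₜ[k] (X : MixedRing k n))

/-- The restriction of a point to the Laurent subring. -/
def torusPart (x : MixedRing k n →ₐ[k] k) : LaurentRing k n →ₐ[k] k := x.comp CAlgHom

/-- The translate of an element of the mixed ring by a `k`-point. -/
def translateBy (x : MixedRing k n →ₐ[k] k) : MixedRing k n →ₐ[k] MixedRing k n :=
  aevalTower (CAlgHom.comp (LaurentRing.translateBy (torusPart x)))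
    (X + algebraMap k (MixedRing k n) (x X))

theorem translateBy_eq_taylor (x : MixedRing k n →ₐ[k] k) (f : MixedRing k n) :
    translateBy x f = taylor (algebraMap k (LaurentRing k n) (x X))
      (f.map (LaurentRing.translateBy (torusPart x) : LaurentRing k n →+* LaurentRing k n)) := by
  have : translateBy x = ((taylorAlgHom (algebraMap k (LaurentRing k n) (x X))).restrictScalars
      k).comp (mapAlgHom (LaurentRing.translateBy (torusPart x))) := by
    refine algHom_ext (fun r => ?_) ?_
    · simp [translateBy]
    · simp [translateBy]
  rw [this]
  rfl

theorem productMap_left_comul (x : MixedRing k n →ₐ[k] k) :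
    (Algebra.TensorProduct.productMap ((Algebra.ofId k (MixedRing k n)).comp x)
      (AlgHom.id k (MixedRing k n))).comp comul = translateBy x := by
  refine algHom_ext (fun r => ?_) ?_
  · have : ((Algebra.TensorProduct.productMap ((Algebra.ofId k (MixedRing k n)).comp x)
      (AlgHom.id k (MixedRing k n))).comp comul).comp CAlgHom =
        (translateBy x).comp CAlgHom := by
      refine LaurentRing.algHom_ext fun a => ?_
      simp only [AlgHom.comp_apply]
      change Algebra.TensorProduct.productMap _ _ (comul (k := k) (n := n) (C _)) =
        translateBy x (C _)
      rw [comul, aevalTower_C, AlgHom.comp_apply, comul_single, Algebra.TensorProduct.map_tmul,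
        Algebra.TensorProduct.productMap_apply_tmul, translateBy, aevalTower_C,
        AlgHom.comp_apply CAlgHom, LaurentRing.translateBy_single]
      change algebraMap k _ (x (C _)) * C _ = C (AddMonoidAlgebra.single a (1 * x (C _)))
      rw [Polynomial.algebraMap_apply, ← C_mul]
      simp [AddMonoidAlgebra.single_mul_single]
    exact AlgHom.congr_fun this r
  · rw [AlgHom.comp_apply, comul, aevalTower_X, map_add,
      Algebra.TensorProduct.productMap_apply_tmul, Algebra.TensorProduct.productMap_apply_tmul,
      translateBy, aevalTower_X]
    simp only [AlgHom.comp_apply, map_one, AlgHom.id_apply, mul_one, one_mul, Algebra.ofId_apply]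
    exact add_comm _ _

theorem productMap_right_comul (x : MixedRing k n →ₐ[k] k) :
    (Algebra.TensorProduct.productMap (AlgHom.id k (MixedRing k n))
      ((Algebra.ofId k (MixedRing k n)).comp x)).comp comul = translateBy x := by
  refine algHom_ext (fun r => ?_) ?_
  · have : ((Algebra.TensorProduct.productMap (AlgHom.id k (MixedRing k n))
      ((Algebra.ofId k (MixedRing k n)).comp x)).comp comul).comp CAlgHom =
        (translateBy x).comp CAlgHom := by
      refine LaurentRing.algHom_ext fun a => ?_
      simp only [AlgHom.comp_apply]
      change Algebra.TensorProduct.productMap _ _ (comul (k := k) (n := n) (C _)) =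
        translateBy x (C _)
      rw [comul, aevalTower_C, AlgHom.comp_apply, comul_single, Algebra.TensorProduct.map_tmul,
        Algebra.TensorProduct.productMap_apply_tmul, translateBy, aevalTower_C,
        AlgHom.comp_apply CAlgHom, LaurentRing.translateBy_single]
      change C _ * algebraMap k _ (x (C _)) = C (AddMonoidAlgebra.single a (1 * x (C _)))
      rw [Polynomial.algebraMap_apply, ← C_mul]
      simp [AddMonoidAlgebra.single_mul_single]
    exact AlgHom.congr_fun this r
  · rw [AlgHom.comp_apply, comul, aevalTower_X, map_add,
      Algebra.TensorProduct.productMap_apply_tmul, Algebra.TensorProduct.productMap_apply_tmul,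
      translateBy, aevalTower_X]
    simp only [AlgHom.comp_apply, map_one, AlgHom.id_apply, mul_one, one_mul, Algebra.ofId_apply]

/-- Evaluation at the point `(t, q)`. -/
def evalAt (q : Fin n → kˣ) (t : k) : MixedRing k n →ₐ[k] k := aevalTower (LaurentRing.evalAt q) t

theorem translate_zpow_X (p : Fin n → kˣ) (i : ℤ) :
    (translate p ^ i) (X : MixedRing k n) = X + (i : MixedRing k n) := by
  have hinv : (translate p)⁻¹ (X : MixedRing k n) = X - 1 := by
    rw [show (translate p)⁻¹ = (translate p).symm from rfl, AlgEquiv.symm_apply_eq, map_sub,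
      translate_X, map_one, add_sub_cancel_right]
  induction i with
  | zero => simp
  | succ i ih =>
    rw [zpow_add_one, AlgEquiv.mul_apply, translate_X, map_add, ih, map_one]
    push_cast
    ring
  | pred i ih =>
    rw [zpow_sub_one, AlgEquiv.mul_apply, hinv, map_sub, ih, map_one]
    push_cast
    ring

theorem translate_zpow_C (p : Fin n → kˣ) (i : ℤ) (r : LaurentRing k n) :
    (translate p ^ i) (C r : MixedRing k n) = C ((scale p ^ i) r) := by
  induction i generalizing r with
  | zero => simp
  | succ i ih =>
    rw [zpow_add_one, AlgEquiv.mul_apply, translate_C, ih, zpow_add_one, AlgEquiv.mul_apply]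
  | pred i ih =>
    have hinv : (translate p)⁻¹ (C r : MixedRing k n) = C ((scale p)⁻¹ r) := by
      rw [show (translate p)⁻¹ = (translate p).symm from rfl, AlgEquiv.symm_apply_eq, translate_C,
        ← AlgEquiv.mul_apply, mul_inv_cancel, AlgEquiv.one_apply]
    rw [zpow_sub_one, AlgEquiv.mul_apply, hinv, ih, zpow_sub_one, AlgEquiv.mul_apply]

theorem translate_zpow_eq_translateBy (p : Fin n → kˣ) (i : ℤ) :
    ((translate p ^ i : MixedRing k n ≃ₐ[k] MixedRing k n) : MixedRing k n →ₐ[k] MixedRing k n) =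
      translateBy (evalAt (p ^ i) i) := by
  refine algHom_ext (fun r => ?_) ?_
  · have ht : torusPart (evalAt (p ^ i) (i : k)) = LaurentRing.evalAt (p ^ i) :=
      AlgHom.ext fun r => aevalTower_C _ _ r
    refine (translate_zpow_C p i r).trans ?_
    rw [translateBy, aevalTower_C, ht, ← scale_eq_translateBy, scale_zpow]
    rfl
  · refine (translate_zpow_X p i).trans ?_
    rw [translateBy, aevalTower_X, evalAt, aevalTower_X, map_intCast]

theorem evalAt_eq_sum (q : Fin n → kˣ) (t : k) (h : MixedRing k n) (S : Finset (Fin n → ℤ))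
    (hS : ∀ j, (h.coeff j).coeff.support ⊆ S) :
    evalAt q t h = ∑ a ∈ S, (∑ j ∈ Finset.range (h.natDegree + 1),
      Polynomial.monomial j ((h.coeff j).coeff a)).eval t * multiplier q a := by
  have h1 : evalAt q t h = ∑ j ∈ Finset.range (h.natDegree + 1),
      LaurentRing.evalAt q (h.coeff j) * t ^ j := by
    change Polynomial.eval₂ _ t h = _
    rw [Polynomial.eval₂_eq_sum_range]
    rfl
  rw [h1]
  simp only [eval_finsetSum, eval_monomial, Finset.sum_mul]
  rw [Finset.sum_comm]
  refine Finset.sum_congr rfl fun j _ => ?_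
  rw [LaurentRing.evalAt_eq_sum, Finsupp.sum_of_support_subset _ (hS j) _ (by simp),
    Finset.sum_mul]
  exact Finset.sum_congr rfl fun a _ => by ring

/-- In characteristic `0` the positive multiples of the point `(1, p)` are Zariski dense. -/
theorem eq_zero_of_forall_evalAt_pow [CharZero k] {p : Fin n → kˣ}
    (hp : LinearIndependent ℤ (fun i => Additive.ofMul (p i))) {h : MixedRing k n}
    (hh : ∀ i : ℕ, evalAt (p ^ ((i : ℤ) + 1)) (((i : ℤ) + 1 : ℤ) : k) h = 0) : h = 0 := by
  classical
  let S := (Finset.range (h.natDegree + 1)).biUnion fun j => (h.coeff j).coeff.support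
  have hS : ∀ j, (h.coeff j).coeff.support ⊆ S := fun j => by
    rcases lt_or_ge h.natDegree j with hj | hj
    · simp [coeff_eq_zero_of_natDegree_lt hj]
    · exact Finset.subset_biUnion_of_mem (fun j => (h.coeff j).coeff.support)
        (Finset.mem_range.2 (Nat.lt_succ_of_le hj))
  have key := fun a (ha : a ∈ S) => eq_zero_of_forall_sum_exponential_eq_zero S
    (fun a => (multiplier p a : k)) (multiplier_injective hp) (fun a => Units.ne_zero _)
    (fun a => ∑ j ∈ Finset.range (h.natDegree + 1),
      Polynomial.monomial j ((h.coeff j).coeff a)) (fun i => by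
      have := hh i
      rw [evalAt_eq_sum _ _ h S hS] at this
      rw [← this]
      refine Finset.sum_congr rfl fun a _ => ?_
      rw [multiplier_zpow, show (i : ℤ) + 1 = ((i + 1 : ℕ) : ℤ) by push_cast; rfl,
        zpow_natCast, Units.val_pow_eq_pow_val,
        Int.cast_natCast, Nat.cast_add_one]) ha
  refine Polynomial.ext fun j => AddMonoidAlgebra.coeff_injective (Finsupp.ext fun a => ?_)
  by_cases ha : a ∈ S
  · have := congrArg (fun q : k[X] => q.coeff j) (key a ha)
    simp only [finsetSum_coeff, coeff_monomial, coeff_zero, Finset.sum_ite_eq',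
      Finset.mem_range] at this
    split_ifs at this with hj
    · exact this
    · simp [coeff_eq_zero_of_natDegree_lt (show h.natDegree < j by omega)]
  · exact Finsupp.notMem_support_iff.1 fun h => ha (hS j h)

end MixedRing

/-! ### Hypersurfaces in the product of the line and the torus -/

namespace MixedRing

open LaurentRing

variable {k : Type*} [Field k] {n : ℕ}

theorem coeff_taylor_of_natDegree_le {R : Type*} [CommRing R] {f : R[X]} {d : ℕ}
    (hd : f.natDegree ≤ d + 1) (r : R) :
    (taylor r f).coeff d = f.coeff d + (d + 1) * f.coeff (d + 1) * r := by
  have hdeg : (hasseDeriv d f).natDegree < 2 := by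
    have := natDegree_hasseDeriv_le f d
    omega
  rw [taylor_coeff, eval_eq_sum_range' hdeg]
  simp only [Finset.sum_range_succ, Finset.sum_range_zero, hasseDeriv_coeff]
  simp [add_comm 1 d]

/-- If `f` has positive degree in `X`, the associate class of a translate determines the first
coordinate of the point: compare the two highest coefficients in `X`. -/
theorem point_X_eq_of_associated [CharZero k] {f : MixedRing k n} {d : ℕ}
    (hd : f.natDegree = d + 1) (x y : MixedRing k n →ₐ[k] k)
    (h : Associated (translateBy x f) (translateBy y f)) : x X = y X := by
  obtain ⟨U, hU⟩ := h
  obtain ⟨r, hr, hrU⟩ := Polynomial.isUnit_iff.1 U.isUnit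
  rw [← hrU, translateBy_eq_taylor, translateBy_eq_taylor] at hU
  have hlead : f.coeff (d + 1) ≠ 0 := by
    rw [← hd]
    refine leadingCoeff_ne_zero.2 ?_
    rintro rfl
    simp at hd
  have htop : ∀ z : MixedRing k n →ₐ[k] k,
      (taylor (algebraMap k (LaurentRing k n) (z X)) (f.map (LaurentRing.translateBy (torusPart z) :
        LaurentRing k n →+* LaurentRing k n))).coeff (d + 1) =
        LaurentRing.translateBy (torusPart z) (f.coeff (d + 1)) := fun z => by
    have hdeg : (f.map (LaurentRing.translateBy (torusPart z) :
        LaurentRing k n →+* LaurentRing k n)).natDegree = d + 1 := by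
      exact (natDegree_map_eq_of_injective
        (f := (LaurentRing.translateBy (torusPart z) : LaurentRing k n →+* LaurentRing k n))
        (LaurentRing.translateBy_injective (torusPart z)) f).trans hd
    have h1 := coeff_taylor_natDegree (algebraMap k (LaurentRing k n) (z X)) (f.map
      (LaurentRing.translateBy (torusPart z) : LaurentRing k n →+* LaurentRing k n))
    rw [leadingCoeff, hdeg, coeff_map] at h1
    exact h1
  have hnext : ∀ z : MixedRing k n →ₐ[k] k,
      (taylor (algebraMap k (LaurentRing k n) (z X)) (f.map (LaurentRing.translateBy (torusPart z) :
        LaurentRing k n →+* LaurentRing k n))).coeff d =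
        LaurentRing.translateBy (torusPart z) (f.coeff d) +
          (d + 1) * LaurentRing.translateBy (torusPart z) (f.coeff (d + 1)) *
            algebraMap k (LaurentRing k n) (z X) := fun z => by
    rw [coeff_taylor_of_natDegree_le (natDegree_map_le.trans hd.le), coeff_map, coeff_map]
    rfl
  have h1 := congrArg (fun F : MixedRing k n => Polynomial.coeff F (d + 1)) hU
  have h2 := congrArg (fun F : MixedRing k n => Polynomial.coeff F d) hU
  simp only [coeff_mul_C, htop, hnext] at h1 h2
  obtain ⟨c, rfl, hc⟩ := exists_scalar_of_translateBy_eq hlead (torusPart x) (torusPart y) hr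
    (h1.symm.trans (mul_comm _ _))
  obtain ⟨a, ha⟩ : (f.coeff (d + 1)).coeff.support.Nonempty := by
    rw [Finsupp.support_nonempty_iff]
    exact fun h => hlead (AddMonoidAlgebra.coeff_eq_zero.1 h)
  have hsplit : ∀ (z : MixedRing k n →ₐ[k] k), (LaurentRing.translateBy (torusPart z) (f.coeff d) +
          (d + 1) * LaurentRing.translateBy (torusPart z) (f.coeff (d + 1)) *
            algebraMap k (LaurentRing k n) (z X)).coeff a =
      torusPart z (AddMonoidAlgebra.single a 1) * ((f.coeff d).coeff a +
        (d + 1) * (f.coeff (d + 1)).coeff a * z X) := fun z => by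
    have e1 : (d + 1) * LaurentRing.translateBy (torusPart z) (f.coeff (d + 1)) *
            algebraMap k (LaurentRing k n) (z X) =
        ((d + 1) * z X : k) • LaurentRing.translateBy (torusPart z) (f.coeff (d + 1)) := by
      rw [Algebra.smul_def, map_mul, map_add, map_natCast, map_one]
      ring
    rw [e1, AddMonoidAlgebra.coeff_add, Finsupp.add_apply, AddMonoidAlgebra.coeff_smul,
      Finsupp.smul_apply, coeff_translateBy, coeff_translateBy, smul_eq_mul]
    ring
  have h3 := congrArg (fun F : LaurentRing k n => F.coeff a) h2
  simp only [AddMonoidAlgebra.coeff_mul_single_zero, hsplit, hc a ha] at h3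
  have hc0 : c * torusPart x (AddMonoidAlgebra.single a 1) ≠ 0 :=
    hc a ha ▸ point_single_ne_zero (torusPart y) a
  have h4 : (f.coeff d).coeff a + (d + 1) * (f.coeff (d + 1)).coeff a * x X =
      (f.coeff d).coeff a + (d + 1) * (f.coeff (d + 1)).coeff a * y X := by
    refine mul_left_cancel₀ hc0 ?_
    rw [← h3]
    ring
  exact mul_left_cancel₀ (mul_ne_zero (Nat.cast_add_one_ne_zero d) (Finsupp.mem_support_iff.1 ha))
    (add_left_cancel h4)

theorem exists_eq_aeval_of_dvd_prod {f : MixedRing k n} {s : Multiset k}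
    (hf : f ∣ (s.map fun v => (X : MixedRing k n) - algebraMap k (MixedRing k n) v).prod) :
    ∃ (u : (MixedRing k n)ˣ) (g : k[X]), u * f = aeval (X : MixedRing k n) g := by
  induction s using Multiset.induction generalizing f with
  | empty =>
    obtain ⟨u, rfl⟩ := isUnit_of_dvd_one (by simpa using hf)
    exact ⟨u⁻¹, 1, by simp⟩
  | cons v s ih =>
    rw [Multiset.map_cons, Multiset.prod_cons] at hf
    have hprime : Prime ((X : MixedRing k n) - algebraMap k (MixedRing k n) v) :=
      prime_X_sub_C (algebraMap k (LaurentRing k n) v)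
    by_cases hv : (X : MixedRing k n) - algebraMap k (MixedRing k n) v ∣ f
    · obtain ⟨f', rfl⟩ := hv
      obtain ⟨u, g, hg⟩ := ih ((mul_dvd_mul_iff_left hprime.ne_zero).1 hf)
      refine ⟨u, (X - C v) * g, ?_⟩
      rw [map_mul, ← hg, map_sub, aeval_X, aeval_C]
      ring
    · obtain ⟨e, he⟩ := hf
      obtain ⟨e', rfl⟩ := (hprime.dvd_or_dvd ⟨_, he.symm⟩).resolve_left hv
      refine ih ⟨e', mul_left_cancel₀ hprime.ne_zero (he.trans ?_)⟩
      ring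

theorem translate_zpow_monomial (p : Fin n → kˣ) (i : ℤ) (a : Fin n → ℤ) :
    (translate p ^ i) (Units.map (C : LaurentRing k n →+* MixedRing k n).toMonoidHom
      (monomial a) : (MixedRing k n)ˣ) =
      algebraMap k (MixedRing k n) ((multiplier p a ^ i : kˣ) : k) *
        (Units.map (C : LaurentRing k n →+* MixedRing k n).toMonoidHom
          (monomial a) : (MixedRing k n)ˣ) := by
  change (translate p ^ i) (C (monomial a : (LaurentRing k n)ˣ)) = _ * C _
  rw [translate_zpow_C, scale_zpow_monomial, C_mul]
  rfl

theorem exists_dvd_prod_sub_of_forall_notMem [IsAlgClosed k] [CharZero k] {p : Fin n → kˣ}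
    (hp : LinearIndependent ℤ (fun i => Additive.ofMul (p i))) {f : MixedRing k n}
    (hf : ∀ i : ℤ, i ≠ 0 → ∀ P : Ideal (MixedRing k n), P.IsPrime → f ∈ P →
      (translate p ^ i) f ∉ P) (w : MixedRing k n)
    (hw : ∀ x y : MixedRing k n →ₐ[k] k, Associated (translateBy x f) (translateBy y f) →
      x w = y w) :
    ∃ s : Multiset k, f ∣ (s.map fun v => w - algebraMap k (MixedRing k n) v).prod :=
  exists_dvd_prod_sub comul
    (fun i : ℕ => evalAt (p ^ ((i : ℤ) + 1)) (((i : ℤ) + 1 : ℤ) : k))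
    (fun h => eq_zero_of_forall_evalAt_pow hp) f
    (fun i P hP hfP => by
      have := hf (i + 1) (by omega) P hP hfP
      rw [← AlgHom.comp_apply, productMap_left_comul, ← translate_zpow_eq_translateBy]
      exact this)
    w (fun x y _ _ h => hw x y (by
      rwa [← AlgHom.comp_apply, productMap_right_comul, ← AlgHom.comp_apply,
        productMap_right_comul] at h))

theorem exists_form_of_forall_notMem [IsAlgClosed k] [CharZero k] {p : Fin n → kˣ}
    (hp : LinearIndependent ℤ (fun i => Additive.ofMul (p i))) {f : MixedRing k n}
    (f0 : f ≠ 0) (hfu : ¬ IsUnit f)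
    (hf : ∀ i : ℤ, i ≠ 0 → ∀ P : Ideal (MixedRing k n), P.IsPrime → f ∈ P →
      (translate p ^ i) f ∉ P) :
    ∃ u : (MixedRing k n)ˣ,
      AdditiveForm k (X : MixedRing k n) ((u : MixedRing k n) * f) ∨
      ∃ a : Fin n → ℤ,
        MultiplicativeForm
          (Units.map (C : LaurentRing k n →+* MixedRing k n).toMonoidHom (monomial a))
          (multiplier p a) ((u : MixedRing k n) * f) := by
  rcases hd : f.natDegree with _ | d
  · rw [eq_C_of_natDegree_eq_zero hd] at f0 hfu hf ⊢
    generalize Polynomial.coeff f 0 = r at *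
    have r0 : r ≠ 0 := by
      rintro rfl
      exact f0 C_0
    obtain ⟨a, ha, b, hb, hab⟩ := exists_ne_of_not_isUnit r0 fun h => hfu (h.map C)
    obtain ⟨s, hs⟩ := exists_dvd_prod_sub_of_forall_notMem hp hf
      (C (AddMonoidAlgebra.single (a - b) 1)) (fun x y h => by
        obtain ⟨U, hU⟩ := h
        obtain ⟨v, hv, hvU⟩ := Polynomial.isUnit_iff.1 U.isUnit
        rw [← hvU, translateBy, translateBy, aevalTower_C, aevalTower_C] at hU
        change C _ * C v = C _ at hU
        rw [← C_mul] at hU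
        exact point_sub_eq_of_translateBy_eq r0 (torusPart x) (torusPart y) hv
          ((C_injective hU).symm.trans (mul_comm _ _)) ha hb)
    have hs' : r ∣ (s.map fun v => AddMonoidAlgebra.single (a - b) 1 -
        algebraMap k (LaurentRing k n) v).prod := by
      have h1 : (s.map fun v => C (AddMonoidAlgebra.single (a - b) 1) -
          algebraMap k (MixedRing k n) v).prod = C (s.map fun v =>
            AddMonoidAlgebra.single (a - b) 1 - algebraMap k (LaurentRing k n) v).prod := by
        rw [map_multiset_prod, Multiset.map_map]
        refine congrArg Multiset.prod (Multiset.map_congr rfl fun v _ => ?_)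
        rw [Function.comp_apply, C_sub]
        rfl
      rw [h1] at hs
      simpa using (C_dvd_iff_dvd_coeff _ _).1 hs 0
    obtain ⟨b', l, d, hl, hd⟩ := exists_primitive (a - b) hab
    rw [hd] at hs' hab
    obtain ⟨u, g, hg⟩ := exists_eq_eval₂_of_dvd_prod hl hab r0 hs'
    refine ⟨Units.map (C : LaurentRing k n →+* MixedRing k n).toMonoidHom u, .inr ⟨b', ?_⟩⟩
    refine multiplicativeForm_of_forall_notMem (g := g) ?_
      (fun i => translate_zpow_monomial p i b') (fun c => ?_) hf
    · refine Eq.trans ?_ ((CAlgHom (R := k) (A := LaurentRing k n)).map_laurentEval₂ _ _)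
      rw [← hg]
      exact (C_mul).symm
    · obtain ⟨y, hy⟩ := exists_point_monomial hl c
      exact ⟨aevalTower y 0, (aevalTower_C _ _ _).trans hy⟩
  · obtain ⟨s, hs⟩ := exists_dvd_prod_sub_of_forall_notMem hp hf X
      fun x y h => point_X_eq_of_associated hd x y h
    obtain ⟨u, g, hg⟩ := exists_eq_aeval_of_dvd_prod hs
    exact ⟨u, .inl (additiveForm_of_forall_notMem hg (translate_zpow_X p)
      (fun a => ⟨evalAt 1 a, aevalTower_X _ _⟩) hf)⟩

theorem isLonely_iff [IsAlgClosed k] [CharZero k] {p : Fin n → kˣ}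
    (hp : LinearIndependent ℤ (fun i => Additive.ofMul (p i))) {f : MixedRing k n}
    (f0 : f ≠ 0) (hfu : ¬ IsUnit f) :
    IsLonely (specAut (translate p)) (vanishing f) ↔
      ∃ u : (MixedRing k n)ˣ,
        AdditiveForm k (X : MixedRing k n) ((u : MixedRing k n) * f) ∨
        ∃ a : Fin n → ℤ,
          MultiplicativeForm
            (Units.map (C : LaurentRing k n →+* MixedRing k n).toMonoidHom (monomial a))
            (multiplier p a) ((u : MixedRing k n) * f) := by
  rw [isLonely_vanishing_iff]
  refine ⟨exists_form_of_forall_notMem hp f0 hfu, ?_⟩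
  rintro ⟨u, h | ⟨a, h⟩⟩ i hi P hP hfP
  · exact h.notMem_of_isPrime u f0 hi (translate_zpow_X p i) hP hfP
  · refine h.notMem_of_isPrime u f0 hfu ?_ (translate_zpow_monomial p i a) hP hfP
    refine (monomial_eq_one_or_multiplier_zpow_ne_one hp a hi).imp_left fun h => ?_
    rw [h, map_one]

end MixedRing

end

theorem mainTheorem6 {k : Type*} [Field k] [IsAlgClosed k] (n : ℕ) (p : Fin n → kˣ)
    (hp : LinearIndependent ℤ (fun i => Additive.ofMul (p i))) :
    (CharZero k → ∀ f : MixedRing k n, f ≠ 0 → ¬ IsUnit f →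
      (IsLonely (specAut (MixedRing.translate p)) (vanishing f) ↔
        ∃ u : (MixedRing k n)ˣ,
          AdditiveForm k (X : MixedRing k n) ((u : MixedRing k n) * f) ∨
          ∃ a : Fin n → ℤ,
            MultiplicativeForm
              (Units.map (C : LaurentRing k n →+* MixedRing k n).toMonoidHom
                (LaurentRing.monomial a))
              (LaurentRing.multiplier p a) ((u : MixedRing k n) * f))) ∧
    (∀ f : LaurentRing k n, f ≠ 0 → ¬ IsUnit f →
      (IsLonely (specAut (LaurentRing.scale p)) (vanishing f) ↔
        ∃ u : (LaurentRing k n)ˣ, ∃ a : Fin n → ℤ,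
          MultiplicativeForm (LaurentRing.monomial a : (LaurentRing k n)ˣ)
            (LaurentRing.multiplier p a) ((u : LaurentRing k n) * f))) :=
  ⟨fun _ _ f0 hfu => MixedRing.isLonely_iff hp f0 hfu,
    fun _ f0 hfu => LaurentRing.isLonely_iff hp f0 hfu⟩
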